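/- Let $k$ be an algebraically closed field of characteristic $p>0$. For $N\ge 0$ let $U_N\subset GL_N$ be the group of upper triangular matrices with ones on the diagonal, so that $k[U_N]=k[x_{i,j}:1\le i<j\le N]$, and let $k[U_N]_{<d}\subset k[U_N]$ be the subspace of polynomials of total degree $<d$ in the $x_{i,j}$. Let $U$ be a (smooth) linear algebraic group over $k$. A rational $U$-module is a right $k[U]$-comodule $\Delta_L:L\to L\otimes k[U]$; it is rationally injective if it is an injective object of the category of right $k[U]$-comodules. (1) Suppose that $U$ is provided with a closed embedding $i:U\to U_N$ for some $N$. For $d>0$ put $k[U]_{<d}=i^*(k[U_N]_{<d})$, which is a sub-coalgebra of $k[U]$, and for a rational $U$-module $L$ put $L_{<d}=\{m\in L:\Delta_L(m)\in L\otimes k[U]_{<d}\}$, which is a right $k[U]_{<d}$-comodule. Then a rational $U$-module $L$ is rationally injective if and only if, for every $r>0$, $L_{<p^r}$ is an injective object of the category of right $k[U]_{<p^r}$-comodules. (2) Suppose that $U\simeq\mathbb G_a$, so that $k[U]\simeq k[T]$ with $\Delta(T)=T\otimes 1+1\otimes T$. For a rational $\mathbb G_a$-module $L$ put $L_{<d}=\{m\in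 L:\Delta_L(m)\in L\otimes k[T]_{<d}\}$, where $k[T]_{<d}$ is the space of polynomials of degree $<d$. Let $\mathbb G_{a(r)}$ be the $r$-th Frobenius kernel of $\mathbb G_a$, with $k[\mathbb G_{a(r)}]=k[T]/(T^{p^r})$, and let $k\mathbb G_{a(r)}$ be its group algebra, the $k$-linear dual of $k[\mathbb G_{a(r)}]$. Then $L$ is rationally injective if and only if, for every $r>0$, the restriction of $L_{<p^r}$ to $\mathbb G_{a(r)}$, viewed as a $k\mathbb G_{a(r)}$-module, is free. -/

import Mathlib

open TensorProduct

universe u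

noncomputable section

namespace RatMod

/-! ## Comodules over coalgebras -/

/-- A right comodule structure on the `k`-vector space `M` over the coalgebra `C`.
A rational module for an affine group scheme `G` over `k` is a right `k[G]`-comodule. -/
@[ext]
structure RightComodule (k C M : Type*) [Field k] [AddCommGroup C] [Module k C] [Coalgebra k C]
    [AddCommGroup M] [Module k M] where
  /-- the coaction -/
  coact : M →ₗ[k] M ⊗[k] C
  coassoc : (TensorProduct.assoc k M C C).toLinearMap ∘ₗ coact.rTensor C ∘ₗ coact =
    (Coalgebra.comul (R := k) (A := C)).lTensor M ∘ₗ coact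
  counit_coact : (TensorProduct.rid k M).toLinearMap ∘ₗ
    (Coalgebra.counit (R := k) (A := C)).lTensor M ∘ₗ coact = LinearMap.id

section

variable {k C D M N : Type*} [Field k]
  [AddCommGroup C] [Module k C] [Coalgebra k C]
  [AddCommGroup D] [Module k D] [Coalgebra k D]
  [AddCommGroup M] [Module k M] [AddCommGroup N] [Module k N]

/-- The linear map `f` is a homomorphism of right comodules. -/
def RightComodule.IsHom (ρ : RightComodule k C M) (σ : RightComodule k C N) (f : M →ₗ[k] N) :
    Prop :=
  f.rTensor C ∘ₗ ρ.coact = σ.coact ∘ₗ f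

/-- Corestriction of a comodule along a homomorphism of coalgebras `π : C → D`:
the coaction becomes `M → M ⊗ C → M ⊗ D`. -/
def RightComodule.push (ρ : RightComodule k C M) (π : C →ₗc[k] D) : RightComodule k D M where
  coact := π.toLinearMap.lTensor M ∘ₗ ρ.coact
  coassoc := by
    have h1 : (TensorProduct.assoc k M D D).toLinearMap ∘ₗ
          (π.toLinearMap.lTensor M ∘ₗ ρ.coact).rTensor D ∘ₗ π.toLinearMap.lTensor M =
        (TensorProduct.map π.toLinearMap π.toLinearMap).lTensor M ∘ₗ
          (TensorProduct.assoc k M C C).toLinearMap ∘ₗ ρ.coact.rTensor C := by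
      ext m c
      simp only [TensorProduct.AlgebraTensorModule.curry_apply, LinearMap.coe_comp,
        Function.comp_apply, TensorProduct.curry_apply, LinearMap.coe_restrictScalars,
        LinearMap.lTensor_tmul, LinearMap.rTensor_tmul, LinearEquiv.coe_coe]
      generalize ρ.coact m = x
      induction x with
      | zero => simp
      | tmul a b => simp
      | add a b ha hb => simp only [map_add, TensorProduct.add_tmul, ha, hb]
    have h2 : (Coalgebra.comul (R := k) (A := D)) ∘ₗ π.toLinearMap =
        TensorProduct.map π.toLinearMap π.toLinearMap ∘ₗ Coalgebra.comul :=
      π.map_comp_comul.symm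
    calc _ = ((TensorProduct.assoc k M D D).toLinearMap ∘ₗ
          (π.toLinearMap.lTensor M ∘ₗ ρ.coact).rTensor D ∘ₗ π.toLinearMap.lTensor M) ∘ₗ
            ρ.coact := rfl
      _ = (TensorProduct.map π.toLinearMap π.toLinearMap).lTensor M ∘ₗ
          ((TensorProduct.assoc k M C C).toLinearMap ∘ₗ ρ.coact.rTensor C ∘ₗ ρ.coact) := by
            rw [h1]; rfl
      _ = _ := by
            rw [ρ.coassoc, ← LinearMap.comp_assoc, ← LinearMap.lTensor_comp, ← h2,
              LinearMap.lTensor_comp, LinearMap.comp_assoc]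
  counit_coact := by
    have h := ρ.counit_coact
    rw [← π.counit_comp, LinearMap.lTensor_comp, LinearMap.comp_assoc] at h
    exact h

end

/-- The comodule `L` is an injective object of the category of right `C`-comodules:
homomorphisms into `L` extend along injective homomorphisms. -/
def RightComodule.IsInjective {k C L : Type u} [Field k]
    [AddCommGroup C] [Module k C] [Coalgebra k C] [AddCommGroup L] [Module k L]
    (ρ : RightComodule k C L) : Prop :=
  ∀ (X Y : Type u) [AddCommGroup X] [Module k X] [AddCommGroup Y] [Module k Y]
    (σ : RightComodule k C X) (τ : RightComodule k C Y)
    (f : X →ₗ[k] Y) (g : X →ₗ[k] L),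
    σ.IsHom τ f → Function.Injective f → σ.IsHom ρ g →
      ∃ h : Y →ₗ[k] L, τ.IsHom ρ h ∧ h ∘ₗ f = g

/-! ## Modules over the dual algebra of a coalgebra -/

section

variable {k C M : Type*} [Field k] [AddCommGroup C] [Module k C] [Coalgebra k C]
  [AddCommGroup M] [Module k M]

/-- The action of a functional on a comodule, `φ(m) = ((1 ⊗ φ) ∘ Δ)(m)`. -/
def RightComodule.dualAct (ρ : RightComodule k C M) (φ : C →ₗ[k] k) : M →ₗ[k] M :=
  (TensorProduct.rid k M).toLinearMap ∘ₗ φ.lTensor M ∘ₗ ρ.coact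

/-- The action `φ(m) = ((1 ⊗ φ) ∘ Δ)(m)` makes a right comodule a left module over the
dual algebra `C* = Hom(C, k)`, whose multiplication is the convolution product. -/
abbrev RightComodule.dualModule (ρ : RightComodule k C M) : Module (WithConv (C →ₗ[k] k)) M where
  smul φ m := ρ.dualAct φ.ofConv m
  one_smul m := by
    have := LinearMap.congr_fun ρ.counit_coact m
    exact this
  mul_smul φ ψ m := by
    change ρ.dualAct (φ * ψ).ofConv m = ρ.dualAct φ.ofConv (ρ.dualAct ψ.ofConv m)
    have h := LinearMap.congr_fun ρ.coassoc m
    simp only [LinearMap.coe_comp, Function.comp_apply, LinearEquiv.coe_coe] at h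
    have h1 : ∀ x : M ⊗[k] C, TensorProduct.rid k M ((φ * ψ).ofConv.lTensor M x) =
        TensorProduct.rid k M ((LinearMap.mul' k k ∘ₗ
          TensorProduct.map φ.ofConv ψ.ofConv).lTensor M
            ((Coalgebra.comul (R := k) (A := C)).lTensor M x)) := by
      intro x
      rw [← LinearMap.comp_apply (LinearMap.lTensor M _), ← LinearMap.lTensor_comp]
      rfl
    have h2 : ∀ x : M ⊗[k] C, TensorProduct.rid k M ((LinearMap.mul' k k ∘ₗ
          TensorProduct.map φ.ofConv ψ.ofConv).lTensor M
            (TensorProduct.assoc k M C C (ρ.coact.rTensor C x))) =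
        ρ.dualAct φ.ofConv (TensorProduct.rid k M (ψ.ofConv.lTensor M x)) := by
      intro x
      induction x with
      | zero => simp
      | add a b ha hb => simp only [map_add, ha, hb]
      | tmul a c =>
        simp only [LinearMap.rTensor_tmul, LinearMap.lTensor_tmul, TensorProduct.rid_tmul,
          map_smul, RightComodule.dualAct, LinearMap.coe_comp, Function.comp_apply,
          LinearEquiv.coe_coe]
        generalize ρ.coact a = y
        induction y with
        | zero => simp
        | add a b ha hb => simp only [map_add, TensorProduct.add_tmul, smul_add, ha, hb]
        | tmul a b => simp [mul_smul, smul_comm (ψ.ofConv c)]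
    change TensorProduct.rid k M ((φ * ψ).ofConv.lTensor M (ρ.coact m)) = _
    rw [h1, ← h, h2]
    rfl
  smul_zero φ := map_zero _
  smul_add φ := map_add _
  add_smul φ ψ m := by
    change TensorProduct.rid k M ((φ.ofConv + ψ.ofConv).lTensor M (ρ.coact m)) = _
    rw [LinearMap.lTensor_add, LinearMap.add_apply, map_add]
    rfl
  zero_smul m := by
    change TensorProduct.rid k M ((0 : C →ₗ[k] k).lTensor M (ρ.coact m)) = _
    rw [LinearMap.lTensor_zero, LinearMap.zero_apply, map_zero]

/-- The comodule `M`, viewed as a module over the dual algebra `C*`, is free. -/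
def RightComodule.IsFreeOverDual (ρ : RightComodule k C M) : Prop :=
  letI : Module (WithConv (C →ₗ[k] k)) M := ρ.dualModule
  Module.Free (WithConv (C →ₗ[k] k)) M

end

/-! ## Subcoalgebras and the associated subcomodules -/

section

variable {k X Y Z : Type*} [Field k] [AddCommGroup X] [Module k X] [AddCommGroup Y] [Module k Y]
  [AddCommGroup Z] [Module k Z]

/-- The factorization of `f` through the injective linear map `j`. -/
def factorThrough (j : X →ₗ[k] Y) (hj : Function.Injective j) (f : Z →ₗ[k] Y)
    (hf : ∀ z, f z ∈ LinearMap.range j) : Z →ₗ[k] X :=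
  (LinearEquiv.ofInjective j hj).symm.toLinearMap ∘ₗ f.codRestrict (LinearMap.range j) hf

theorem comp_factorThrough (j : X →ₗ[k] Y) (hj : Function.Injective j) (f : Z →ₗ[k] Y)
    (hf : ∀ z, f z ∈ LinearMap.range j) : j ∘ₗ factorThrough j hj f hf = f := by
  ext z
  have := congrArg Subtype.val
    ((LinearEquiv.ofInjective j hj).apply_symm_apply (f.codRestrict (LinearMap.range j) hf z))
  exact this

end

section

theorem map_subtype_injective {k C M : Type*} [Field k] [AddCommGroup C] [Module k C]
    [AddCommGroup M] [Module k M] (P : Submodule k M) (B : Submodule k C) :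
    Function.Injective (TensorProduct.map P.subtype B.subtype) :=
  TensorProduct.map_injective_of_flat_flat _ _ P.injective_subtype B.injective_subtype

variable {k C M : Type*} [Field k] [AddCommGroup C] [Module k C] [Coalgebra k C]
  [AddCommGroup M] [Module k M]

/-- A subspace `B ⊆ C` with `Δ(B) ⊆ B ⊗ B`. -/
class IsSubcoalgebra (B : Submodule k C) : Prop where
  comul_mem : ∀ b ∈ B, (Coalgebra.comul (R := k) b : C ⊗[k] C) ∈
    LinearMap.range (TensorProduct.map B.subtype B.subtype)

variable (B : Submodule k C) [hB : IsSubcoalgebra B]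

/-- The restriction `B → B ⊗ B` of the coproduct of `C`. -/
def subComul : B →ₗ[k] B ⊗[k] B :=
  factorThrough (TensorProduct.map B.subtype B.subtype) (map_subtype_injective B B)
    (Coalgebra.comul ∘ₗ B.subtype) fun b => hB.comul_mem b b.2

theorem map_subComul : TensorProduct.map B.subtype B.subtype ∘ₗ subComul B =
    Coalgebra.comul ∘ₗ B.subtype :=
  comp_factorThrough _ _ _ _

/-- A subcoalgebra is a coalgebra, with the restricted coproduct and counit. -/
instance subCoalgebra : Coalgebra k B where
  comul := subComul B
  counit := Coalgebra.counit ∘ₗ B.subtype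
  coassoc := by
    have hinj : Function.Injective (TensorProduct.map B.subtype
        (TensorProduct.map B.subtype B.subtype)) :=
      TensorProduct.map_injective_of_flat_flat _ _ B.injective_subtype (map_subtype_injective B B)
    have hj := map_subComul B
    rw [← LinearMap.cancel_left hinj]
    have e1 : TensorProduct.map B.subtype (TensorProduct.map B.subtype B.subtype) ∘ₗ
        (TensorProduct.assoc k B B B).toLinearMap =
        (TensorProduct.assoc k C C C).toLinearMap ∘ₗ
          TensorProduct.map (TensorProduct.map B.subtype B.subtype) B.subtype := by
      ext; simp
    calc _ = (TensorProduct.map B.subtype (TensorProduct.map B.subtype B.subtype) ∘ₗ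
        (TensorProduct.assoc k B B B).toLinearMap) ∘ₗ (subComul B).rTensor B ∘ₗ subComul B := rfl
      _ = (TensorProduct.assoc k C C C).toLinearMap ∘ₗ
          (TensorProduct.map (TensorProduct.map B.subtype B.subtype ∘ₗ subComul B) B.subtype) ∘ₗ
            subComul B := by
          rw [e1, LinearMap.comp_assoc, ← LinearMap.comp_assoc (subComul B),
            LinearMap.map_comp_rTensor]
      _ = (TensorProduct.assoc k C C C).toLinearMap ∘ₗ Coalgebra.comul.rTensor C ∘ₗ
          (TensorProduct.map B.subtype B.subtype ∘ₗ subComul B) := by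
          rw [hj, ← LinearMap.rTensor_comp_map, LinearMap.comp_assoc, hj]
      _ = Coalgebra.comul.lTensor C ∘ₗ
          (TensorProduct.map B.subtype B.subtype ∘ₗ subComul B) := by
          rw [hj]
          exact congrArg (· ∘ₗ B.subtype) (Coalgebra.coassoc (R := k) (A := C))
      _ = _ := by
          rw [← LinearMap.comp_assoc, LinearMap.lTensor_comp_map, ← hj,
            ← LinearMap.map_comp_lTensor, LinearMap.comp_assoc]
  rTensor_counit_comp_comul := by
    have hinj : Function.Injective (B.subtype.lTensor k) :=
      Module.Flat.lTensor_preserves_injective_linearMap _ B.injective_subtype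
    rw [← LinearMap.cancel_left hinj]
    calc _ = (Coalgebra.counit.rTensor C) ∘ₗ
          (TensorProduct.map B.subtype B.subtype ∘ₗ subComul B) := by
          rw [← LinearMap.comp_assoc, LinearMap.lTensor_comp_rTensor, ← LinearMap.comp_assoc,
            LinearMap.rTensor_comp_map]
      _ = _ := by
          rw [map_subComul, ← LinearMap.comp_assoc, Coalgebra.rTensor_counit_comp_comul]
          ext; simp
  lTensor_counit_comp_comul := by
    have hinj : Function.Injective (B.subtype.rTensor k) :=
      Module.Flat.rTensor_preserves_injective_linearMap _ B.injective_subtype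
    rw [← LinearMap.cancel_left hinj]
    calc _ = (Coalgebra.counit.lTensor C) ∘ₗ
          (TensorProduct.map B.subtype B.subtype ∘ₗ subComul B) := by
          rw [← LinearMap.comp_assoc, LinearMap.rTensor_comp_lTensor, ← LinearMap.comp_assoc,
            LinearMap.lTensor_comp_map]
      _ = _ := by
          rw [map_subComul, ← LinearMap.comp_assoc, Coalgebra.lTensor_counit_comp_comul]
          ext; simp

/-- The inclusion of a subcoalgebra, as a homomorphism of coalgebras. -/
def subCoalgebraIncl : B →ₗc[k] C where
  toLinearMap := B.subtype
  counit_comp := rfl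
  map_comp_comul := map_subComul B

/-- The subspace `{m ∈ M : Δ_M(m) ∈ M ⊗ B}` of a comodule `M`. -/
def RightComodule.part (ρ : RightComodule k C M) (B : Submodule k C) : Submodule k M :=
  (LinearMap.range (B.subtype.lTensor M)).comap ρ.coact

theorem RightComodule.coact_mem_range (ρ : RightComodule k C M) (m : ρ.part B) :
    ρ.coact m ∈ LinearMap.range (TensorProduct.map (ρ.part B).subtype B.subtype) := by
  obtain ⟨x, hx⟩ : ∃ x, B.subtype.lTensor M x = ρ.coact m := m.2
  let θ : M →ₗ[k] M ⊗[k] (C ⧸ B) := B.mkQ.lTensor M ∘ₗ ρ.coact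
  have hex : Function.Exact (B.subtype.lTensor M) (B.mkQ.lTensor M) :=
    Module.Flat.lTensor_exact M (LinearMap.exact_subtype_mkQ B)
  have hθ : Function.Exact (ρ.part B).subtype θ := by
    intro y
    change B.mkQ.lTensor M (ρ.coact y) = 0 ↔ _
    rw [hex (ρ.coact y)]
    exact ⟨fun h => ⟨⟨y, h⟩, rfl⟩, fun ⟨z, hz⟩ => hz ▸ z.2⟩
  have hθB : Function.Exact ((ρ.part B).subtype.rTensor B) (θ.rTensor B) :=
    Module.Flat.rTensor_exact B hθ
  have h0 : θ.rTensor B x = 0 := by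
    have hinj : Function.Injective (B.subtype.lTensor (M ⊗[k] (C ⧸ B))) :=
      Module.Flat.lTensor_preserves_injective_linearMap _ B.injective_subtype
    apply hinj
    apply (TensorProduct.assoc k M (C ⧸ B) C).injective
    have e1 : ∀ y : M ⊗[k] C, TensorProduct.assoc k M (C ⧸ B) C (θ.rTensor C y) =
        (B.mkQ.rTensor C).lTensor M (TensorProduct.assoc k M C C (ρ.coact.rTensor C y)) := by
      intro y
      induction y with
      | zero => simp
      | add a b ha hb => simp only [map_add, ha, hb]
      | tmul a c =>
        simp only [LinearMap.rTensor_tmul, θ, LinearMap.coe_comp, Function.comp_apply]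
        generalize ρ.coact a = y
        induction y with
        | zero => simp
        | add a b ha hb => simp only [map_add, TensorProduct.add_tmul, ha, hb]
        | tmul a b => simp
    have e2 : B.subtype.lTensor (M ⊗[k] (C ⧸ B)) (θ.rTensor B x) = θ.rTensor C (ρ.coact m) := by
      rw [← hx, ← LinearMap.comp_apply, ← LinearMap.comp_apply, LinearMap.lTensor_comp_rTensor,
        LinearMap.rTensor_comp_lTensor]
    have e3 := LinearMap.congr_fun ρ.coassoc m
    simp only [LinearMap.coe_comp, Function.comp_apply, LinearEquiv.coe_coe] at e3
    have e4 : B.mkQ.rTensor C ∘ₗ Coalgebra.comul ∘ₗ B.subtype = 0 := by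
      rw [← map_subComul, ← LinearMap.comp_assoc, LinearMap.rTensor_comp_map,
        (LinearMap.exact_subtype_mkQ B).linearMap_comp_eq_zero, TensorProduct.map_zero_left, LinearMap.zero_comp]
    rw [e2, e1, e3, ← hx, ← LinearMap.comp_apply, ← LinearMap.comp_apply,
      ← LinearMap.lTensor_comp, ← LinearMap.lTensor_comp, LinearMap.comp_assoc, e4]
    simp
  obtain ⟨z, hz⟩ := (hθB x).1 h0
  refine ⟨z, ?_⟩
  rw [← hx, ← hz, ← LinearMap.comp_apply, LinearMap.lTensor_comp_rTensor]

/-- For a subcoalgebra `B ⊆ C`, the subspace `{m ∈ M : Δ_M(m) ∈ M ⊗ B}` is a right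
`B`-comodule, with the restricted coaction. -/
def RightComodule.restrict (ρ : RightComodule k C M) : RightComodule k B (ρ.part B) where
  coact := factorThrough (TensorProduct.map (ρ.part B).subtype B.subtype)
    (map_subtype_injective _ _) (ρ.coact ∘ₗ (ρ.part B).subtype) (ρ.coact_mem_range B)
  coassoc := by
    have hinj : Function.Injective (TensorProduct.map (ρ.part B).subtype
        (TensorProduct.map B.subtype B.subtype)) :=
      TensorProduct.map_injective_of_flat_flat _ _ (ρ.part B).injective_subtype
        (map_subtype_injective B B)
    have hj := comp_factorThrough (TensorProduct.map (ρ.part B).subtype B.subtype)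
      (map_subtype_injective _ _) (ρ.coact ∘ₗ (ρ.part B).subtype) (ρ.coact_mem_range B)
    set δ := factorThrough (TensorProduct.map (ρ.part B).subtype B.subtype)
      (map_subtype_injective _ _) (ρ.coact ∘ₗ (ρ.part B).subtype) (ρ.coact_mem_range B) with hδ
    rw [← LinearMap.cancel_left hinj]
    have e1 : TensorProduct.map (ρ.part B).subtype (TensorProduct.map B.subtype B.subtype) ∘ₗ
        (TensorProduct.assoc k (ρ.part B) B B).toLinearMap =
        (TensorProduct.assoc k M C C).toLinearMap ∘ₗ
          TensorProduct.map (TensorProduct.map (ρ.part B).subtype B.subtype) B.subtype := by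
      ext; simp
    calc _ = (TensorProduct.map (ρ.part B).subtype (TensorProduct.map B.subtype B.subtype) ∘ₗ
        (TensorProduct.assoc k (ρ.part B) B B).toLinearMap) ∘ₗ δ.rTensor B ∘ₗ δ := rfl
      _ = (TensorProduct.assoc k M C C).toLinearMap ∘ₗ
          (TensorProduct.map (TensorProduct.map (ρ.part B).subtype B.subtype ∘ₗ δ) B.subtype) ∘ₗ
            δ := by
          rw [e1, LinearMap.comp_assoc, ← LinearMap.comp_assoc δ, LinearMap.map_comp_rTensor]
      _ = (TensorProduct.assoc k M C C).toLinearMap ∘ₗ ρ.coact.rTensor C ∘ₗ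
          (TensorProduct.map (ρ.part B).subtype B.subtype ∘ₗ δ) := by
          rw [hj, ← LinearMap.rTensor_comp_map, LinearMap.comp_assoc, hj]
      _ = Coalgebra.comul.lTensor M ∘ₗ
          (TensorProduct.map (ρ.part B).subtype B.subtype ∘ₗ δ) := by
          rw [hj]
          exact congrArg (· ∘ₗ (ρ.part B).subtype) ρ.coassoc
      _ = TensorProduct.map (ρ.part B).subtype (TensorProduct.map B.subtype B.subtype) ∘ₗ
            (subComul B).lTensor (ρ.part B) ∘ₗ δ := by
          rw [← LinearMap.comp_assoc, LinearMap.lTensor_comp_map, ← map_subComul B,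
            ← LinearMap.map_comp_lTensor, LinearMap.comp_assoc]
  counit_coact := by
    have hj := comp_factorThrough (TensorProduct.map (ρ.part B).subtype B.subtype)
      (map_subtype_injective _ _) (ρ.coact ∘ₗ (ρ.part B).subtype) (ρ.coact_mem_range B)
    set δ := factorThrough (TensorProduct.map (ρ.part B).subtype B.subtype)
      (map_subtype_injective _ _) (ρ.coact ∘ₗ (ρ.part B).subtype) (ρ.coact_mem_range B) with hδ
    rw [← LinearMap.cancel_left (ρ.part B).injective_subtype]
    have e1 : (ρ.part B).subtype ∘ₗ (TensorProduct.rid k (ρ.part B)).toLinearMap ∘ₗ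
        (Coalgebra.counit (R := k) (A := B)).lTensor (ρ.part B) =
        (TensorProduct.rid k M).toLinearMap ∘ₗ (Coalgebra.counit (R := k) (A := C)).lTensor M ∘ₗ
          TensorProduct.map (ρ.part B).subtype B.subtype := by
      ext a b
      simp [Coalgebra.counit]
    calc _ = ((ρ.part B).subtype ∘ₗ (TensorProduct.rid k (ρ.part B)).toLinearMap ∘ₗ
        (Coalgebra.counit (R := k) (A := B)).lTensor (ρ.part B)) ∘ₗ δ := rfl
      _ = ((TensorProduct.rid k M).toLinearMap ∘ₗ
          (Coalgebra.counit (R := k) (A := C)).lTensor M) ∘ₗ ρ.coact ∘ₗ (ρ.part B).subtype := by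
          rw [e1, ← hj]; rfl
      _ = _ := congrArg (· ∘ₗ (ρ.part B).subtype) ρ.counit_coact

/-- The coaction of `ρ.restrict B` is the restriction of the coaction of `ρ`. -/
theorem RightComodule.map_coact_restrict (ρ : RightComodule k C M) :
    TensorProduct.map (ρ.part B).subtype B.subtype ∘ₗ (ρ.restrict B).coact =
      ρ.coact ∘ₗ (ρ.part B).subtype :=
  comp_factorThrough _ _ _ _

end

/-! ## The group `U_N` of strictly upper triangular (unipotent) matrices -/

section

open MvPolynomial

/-- The coordinate algebra `k[U_N] = k[x_{i,j} : i < j]` of the group `U_N ⊆ GL_N` of upper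
triangular matrices with ones on the diagonal. This is a separate type, so that it does not inherit the
coalgebra structure that `MvPolynomial` has as a monoid algebra. -/
def UCoord (k : Type*) [Field k] (N : ℕ) : Type _ :=
  MvPolynomial {q : Fin N × Fin N // q.1 < q.2} k

variable (k : Type*) [Field k] (N : ℕ)

instance : CommRing (UCoord k N) :=
  inferInstanceAs (CommRing (MvPolynomial {q : Fin N × Fin N // q.1 < q.2} k))

instance : Algebra k (UCoord k N) :=
  inferInstanceAs (Algebra k (MvPolynomial {q : Fin N × Fin N // q.1 < q.2} k))

/-- The identification of `k[U_N]` with the polynomial algebra on the `x_{i,j}`, `i < j`. -/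
def uEquiv : MvPolynomial {q : Fin N × Fin N // q.1 < q.2} k ≃ₐ[k] UCoord k N :=
  (AlgEquiv.refl : MvPolynomial {q : Fin N × Fin N // q.1 < q.2} k ≃ₐ[k]
    MvPolynomial {q : Fin N × Fin N // q.1 < q.2} k)

/-- The coordinate function `x_{i,j}`, for `q = (i, j)` with `i < j`. -/
def uX (q : {q : Fin N × Fin N // q.1 < q.2}) : UCoord k N :=
  uEquiv k N (X q)

variable {k N} in
/-- The homomorphism of `k`-algebras out of `k[U_N]` with prescribed values on the `x_{i,j}`. -/
def uLift {B : Type*} [CommRing B] [Algebra k B] (v : {q : Fin N × Fin N // q.1 < q.2} → B) :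
    UCoord k N →ₐ[k] B :=
  (aeval v).comp (uEquiv k N).symm.toAlgHom

variable {k N} in
theorem uLift_uX {B : Type*} [CommRing B] [Algebra k B]
    (v : {q : Fin N × Fin N // q.1 < q.2} → B) (q : {q : Fin N × Fin N // q.1 < q.2}) :
    uLift v (uX k N q) = v q := by
  simp [uLift, uX]

variable {k N} in
theorem uCoord_algHom_ext {B : Type*} [CommRing B] [Algebra k B] {f g : UCoord k N →ₐ[k] B}
    (h : ∀ q, f (uX k N q) = g (uX k N q)) : f = g := by
  have h' : f.comp (uEquiv k N).toAlgHom = g.comp (uEquiv k N).toAlgHom :=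
    MvPolynomial.algHom_ext fun q => h q
  ext x
  obtain ⟨y, rfl⟩ := (uEquiv k N).surjective x
  exact DFunLike.congr_fun h' y

/-- The generic upper triangular unipotent matrix: its entries are `x_{i,j}` for `i < j`,
`1` for `i = j` and `0` for `i > j`. -/
def uMat : Matrix (Fin N) (Fin N) (UCoord k N) := fun i j =>
  if h : i < j then uX k N ⟨(i, j), h⟩ else if i = j then 1 else 0

/-- The coproduct of `k[U_N]`, dual to matrix multiplication: `x_{i,j} ↦ ∑ₜ x_{i,t} ⊗ x_{t,j}`,
where `x_{i,i} = 1` and `x_{i,t} = 0` for `i > t`. -/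
def uComul : UCoord k N →ₐ[k] UCoord k N ⊗[k] UCoord k N :=
  uLift fun q => ∑ t, uMat k N q.1.1 t ⊗ₜ[k] uMat k N t q.1.2

/-- The counit of `k[U_N]`: evaluation at the identity matrix, `x_{i,j} ↦ 0`. -/
def uCounit : UCoord k N →ₐ[k] k := uLift fun _ => 0

theorem uComul_uMat (i j : Fin N) :
    uComul k N (uMat k N i j) = ∑ t, uMat k N i t ⊗ₜ[k] uMat k N t j := by
  rcases lt_trichotomy i j with h | h | h
  · conv_lhs => rw [uMat, dif_pos h, uComul, uLift_uX]
  · subst h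
    have hl : uMat k N i i = 1 := by simp [uMat]
    rw [hl, map_one, Finset.sum_eq_single i, hl, Algebra.TensorProduct.one_def]
    · intro t _ ht
      rcases lt_or_gt_of_ne ht with h | h
      · have : uMat k N i t = 0 := by simp [uMat, h.not_gt, h.ne']
        rw [this, TensorProduct.zero_tmul]
      · have : uMat k N t i = 0 := by simp [uMat, h.not_gt, h.ne']
        rw [this, TensorProduct.tmul_zero]
    · simp
  · have hl : uMat k N i j = 0 := by simp [uMat, h.not_gt, h.ne']
    rw [hl, map_zero]
    symm
    apply Finset.sum_eq_zero
    intro t _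
    rcases lt_or_ge t i with h' | h'
    · have : uMat k N i t = 0 := by simp [uMat, h'.not_gt, h'.ne']
      rw [this, TensorProduct.zero_tmul]
    · have h'' := h.trans_le h'
      have : uMat k N t j = 0 := by simp [uMat, h''.not_gt, h''.ne']
      rw [this, TensorProduct.tmul_zero]

theorem uCounit_uMat (i j : Fin N) :
    uCounit k N (uMat k N i j) = (1 : Matrix (Fin N) (Fin N) k) i j := by
  unfold uMat uCounit
  split_ifs with h h'
  · rw [uLift_uX, Matrix.one_apply_ne h.ne]
  · subst h'; simp
  · rw [map_zero, Matrix.one_apply_ne h']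

theorem uX_eq_uMat (q : {q : Fin N × Fin N // q.1 < q.2}) :
    uX k N q = uMat k N q.1.1 q.1.2 := by
  rw [uMat, dif_pos q.2]

instance uBialgebra : Bialgebra k (UCoord k N) :=
  .ofAlgHom (uComul k N) (uCounit k N)
    (by
      apply uCoord_algHom_ext
      intro q
      rw [uX_eq_uMat]
      simp only [AlgHom.coe_comp, Function.comp_apply, uComul_uMat, map_sum,
        Algebra.TensorProduct.map_tmul, AlgHom.id_apply, TensorProduct.sum_tmul,
        TensorProduct.tmul_sum]
      exact Finset.sum_comm)
    (by
      apply uCoord_algHom_ext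
      intro q
      rw [uX_eq_uMat]
      simp [uComul_uMat, uCounit_uMat, Matrix.one_apply, ite_tmul])
    (by
      apply uCoord_algHom_ext
      intro q
      rw [uX_eq_uMat]
      simp [uComul_uMat, uCounit_uMat, Matrix.one_apply, tmul_ite])

theorem uMat_blockTriangular : (uMat k N).BlockTriangular id := by
  intro i j h
  have h : j < i := h
  simp [uMat, h.not_gt, h.ne']

theorem det_uMat : (uMat k N).det = 1 := by
  rw [Matrix.det_of_isUpperTriangular (uMat_blockTriangular k N)]
  simp [uMat]

theorem uInv_blockTriangular : ((uMat k N)⁻¹).BlockTriangular id := by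
  have : Invertible (uMat k N) := Matrix.invertibleOfIsUnitDet _ (by simp [det_uMat])
  exact Matrix.blockTriangular_inv_of_blockTriangular (uMat_blockTriangular k N)

theorem uMat_mul_inv : uMat k N * (uMat k N)⁻¹ = 1 :=
  Matrix.mul_nonsing_inv _ (by simp [det_uMat])

theorem uMat_inv_mul : (uMat k N)⁻¹ * uMat k N = 1 :=
  Matrix.nonsing_inv_mul _ (by simp [det_uMat])

theorem uInv_diag (i : Fin N) : (uMat k N)⁻¹ i i = 1 := by
  have h := congrFun (congrFun (uMat_mul_inv k N) i) i
  rw [Matrix.mul_apply, Finset.sum_eq_single i] at h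
  · simpa [uMat] using h
  · intro t _ ht
    rcases lt_or_gt_of_ne ht with h' | h'
    · rw [uMat_blockTriangular k N (i := i) (j := t) h', zero_mul]
    · rw [uInv_blockTriangular k N (i := t) (j := i) h', mul_zero]
  · simp

/-- The antipode of `k[U_N]`, dual to matrix inversion. -/
def uAntipode : UCoord k N →ₐ[k] UCoord k N := uLift fun q => (uMat k N)⁻¹ q.1.1 q.1.2

theorem uAntipode_uMat (i j : Fin N) : uAntipode k N (uMat k N i j) = (uMat k N)⁻¹ i j := by
  rcases lt_trichotomy i j with h | h | h
  · conv_lhs => rw [uMat, dif_pos h, uAntipode, uLift_uX]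
  · subst h
    rw [uInv_diag]
    simp [uMat]
  · rw [uMat_blockTriangular k N (i := i) (j := j) h, map_zero,
      uInv_blockTriangular k N (i := i) (j := j) h]

instance uHopfAlgebra : HopfAlgebra k (UCoord k N) :=
  .ofAlgHom (uAntipode k N)
    (by
      apply uCoord_algHom_ext
      intro q
      rw [uX_eq_uMat]
      have h := congrFun (congrFun (uMat_inv_mul k N) q.1.1) q.1.2
      change Algebra.TensorProduct.lift _ _ (fun _ _ => Commute.all _ _) (uComul k N _) =
        algebraMap k _ (uCounit k N _)
      rw [uComul_uMat, uCounit_uMat, map_sum]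
      simp only [Algebra.TensorProduct.lift_tmul, uAntipode_uMat, AlgHom.id_apply]
      rw [← Matrix.mul_apply, h]
      simp only [Matrix.one_apply, apply_ite (algebraMap k (UCoord k N)), map_one, map_zero])
    (by
      apply uCoord_algHom_ext
      intro q
      rw [uX_eq_uMat]
      have h := congrFun (congrFun (uMat_mul_inv k N) q.1.1) q.1.2
      change Algebra.TensorProduct.lift _ _ (fun _ _ => Commute.all _ _) (uComul k N _) =
        algebraMap k _ (uCounit k N _)
      rw [uComul_uMat, uCounit_uMat, map_sum]
      simp only [Algebra.TensorProduct.lift_tmul, uAntipode_uMat, AlgHom.id_apply]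
      rw [← Matrix.mul_apply, h]
      simp only [Matrix.one_apply, apply_ite (algebraMap k (UCoord k N)), map_one, map_zero])

/-- The subspace `k[U_N]_{<d}` of polynomials of total degree `< d` in the `x_{i,j}`. -/
def uDegreeLT (d : ℕ) : Submodule k (UCoord k N) :=
  (restrictSupport k {s | s.degree < d}).map (uEquiv k N).toLinearMap

theorem mul_mem_uRange {a b : ℕ} {x y : UCoord k N ⊗[k] UCoord k N}
    (hx : x ∈ LinearMap.range
      (TensorProduct.map (uDegreeLT k N (a + 1)).subtype (uDegreeLT k N (a + 1)).subtype))
    (hy : y ∈ LinearMap.range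
      (TensorProduct.map (uDegreeLT k N (b + 1)).subtype (uDegreeLT k N (b + 1)).subtype)) :
    x * y ∈ LinearMap.range (TensorProduct.map (uDegreeLT k N (a + b + 1)).subtype
      (uDegreeLT k N (a + b + 1)).subtype) := by
  have hmul : ∀ f ∈ uDegreeLT k N (a + 1), ∀ g ∈ uDegreeLT k N (b + 1),
      f * g ∈ uDegreeLT k N (a + b + 1) := by
    rintro _ ⟨f, hf, rfl⟩ _ ⟨g, hg, rfl⟩
    have h := Submodule.mul_mem_mul hf hg
    rw [← restrictSupport_add] at h
    refine ⟨f * g, restrictSupport_mono k ?_ h, map_mul (uEquiv k N) f g⟩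
    rintro _ ⟨s, hs, t, ht, rfl⟩
    simp only [Set.mem_ofPred_eq, map_add] at hs ht ⊢
    omega
  obtain ⟨x, rfl⟩ := hx
  obtain ⟨y, rfl⟩ := hy
  induction x with
  | zero => simp
  | add x x' hx hx' =>
    rw [map_add, add_mul]
    exact add_mem hx hx'
  | tmul f f' =>
    induction y with
    | zero => simp
    | add y y' hy hy' =>
      rw [map_add, mul_add]
      exact add_mem hy hy'
    | tmul g g' =>
      exact ⟨⟨_, hmul f f.2 g g.2⟩ ⊗ₜ ⟨_, hmul f' f'.2 g' g'.2⟩, by simp⟩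

theorem one_mem_uDegreeLT (d : ℕ) : 1 ∈ uDegreeLT k N (d + 1) :=
  ⟨1, (monomial_mem_restrictSupport k).2 (Or.inl (by simp)), map_one (uEquiv k N)⟩

theorem uMat_mem (i j : Fin N) : uMat k N i j ∈ uDegreeLT k N 2 := by
  unfold uMat
  split_ifs with h h'
  · exact ⟨_, (monomial_mem_restrictSupport k).2 (Or.inl (by simp)), rfl⟩
  · exact one_mem_uDegreeLT k N 1
  · exact zero_mem _

theorem comul_monomial_mem (s : {q : Fin N × Fin N // q.1 < q.2} →₀ ℕ) :
    uComul k N (uEquiv k N (monomial s 1)) ∈ LinearMap.range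
      (TensorProduct.map (uDegreeLT k N (s.degree + 1)).subtype
        (uDegreeLT k N (s.degree + 1)).subtype) := by
  have h1' : uComul k N 1 ∈ LinearMap.range
      (TensorProduct.map (uDegreeLT k N 1).subtype (uDegreeLT k N 1).subtype) := by
    rw [map_one, Algebra.TensorProduct.one_def]
    exact ⟨⟨1, one_mem_uDegreeLT k N 0⟩ ⊗ₜ ⟨1, one_mem_uDegreeLT k N 0⟩, by simp⟩
  induction s using Finsupp.induction_linear with
  | zero =>
    rw [map_zero, monomial_zero', C_1, map_one (uEquiv k N)]
    exact h1'
  | add s t hs ht =>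
    have h : (monomial (s + t) (1 : k)) = monomial s 1 * monomial t 1 := by simp
    rw [h, map_mul, map_mul, map_add]
    exact mul_mem_uRange k N hs ht
  | single q n =>
    rw [← X_pow_eq_monomial, Finsupp.degree_single]
    induction n with
    | zero =>
      rw [pow_zero, map_one (uEquiv k N)]
      exact h1'
    | succ n ih =>
      rw [pow_succ, map_mul, map_mul]
      refine mul_mem_uRange k N ih ?_
      change uComul k N (uX k N q) ∈ _
      rw [uX_eq_uMat, uComul_uMat]
      exact Submodule.sum_mem _ fun t _ =>
        ⟨⟨_, uMat_mem k N q.1.1 t⟩ ⊗ₜ ⟨_, uMat_mem k N t q.1.2⟩, by simp⟩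

theorem range_map_subtype_mono {C : Type*} [AddCommGroup C] [Module k C] {P Q : Submodule k C}
    (h : P ≤ Q) : LinearMap.range (TensorProduct.map P.subtype P.subtype) ≤
      LinearMap.range (TensorProduct.map Q.subtype Q.subtype) := by
  have : TensorProduct.map P.subtype P.subtype = TensorProduct.map Q.subtype Q.subtype ∘ₗ
      TensorProduct.map (Submodule.inclusion h) (Submodule.inclusion h) := by
    ext; simp
  rw [this]
  exact LinearMap.range_comp_le_range _ _

instance (d : ℕ) : IsSubcoalgebra (uDegreeLT k N d) where
  comul_mem f hf := by
    obtain ⟨f, hf, rfl⟩ := hf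
    change uComul k N (uEquiv k N f) ∈ LinearMap.range
      (TensorProduct.map (uDegreeLT k N d).subtype (uDegreeLT k N d).subtype)
    rw [SetLike.mem_coe, restrictSupport_eq_span] at hf
    induction hf using Submodule.span_induction with
    | zero => rw [map_zero, map_zero]; exact zero_mem _
    | add x y _ _ hx hy => rw [map_add, map_add]; exact add_mem hx hy
    | smul a x _ hx => rw [map_smul, map_smul]; exact Submodule.smul_mem _ _ hx
    | mem x hx =>
      obtain ⟨s, hs, rfl⟩ := hx
      exact range_map_subtype_mono k (Submodule.map_mono (restrictSupport_mono k
        fun t (ht : _ < _) => lt_of_lt_of_le ht (Nat.succ_le_of_lt hs))) (comul_monomial_mem k N s)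

variable {k N} {A : Type*} [CommRing A] [HopfAlgebra k A]

/-- For a closed embedding `U → U_N`, given by `i* : k[U_N] → k[U]`, the subspace
`k[U]_{<d} ⊆ k[U]` is the image of `k[U_N]_{<d}`. -/
def degreeLT (i : UCoord k N →ₐc[k] A) (d : ℕ) : Submodule k A :=
  (uDegreeLT k N d).map (i : UCoord k N →ₗ[k] A)

instance (i : UCoord k N →ₐc[k] A) (d : ℕ) : IsSubcoalgebra (degreeLT i d) where
  comul_mem := by
    rintro _ ⟨f, hf, rfl⟩
    obtain ⟨x, hx⟩ := IsSubcoalgebra.comul_mem f hf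
    have h : Coalgebra.comul (R := k) (i f) =
        TensorProduct.map (i : UCoord k N →ₗ[k] A) (i : UCoord k N →ₗ[k] A)
          (Coalgebra.comul f) := (CoalgHomClass.map_comp_comul_apply i f).symm
    change Coalgebra.comul (R := k) (i f) ∈ _
    rw [h, ← hx]
    let j : uDegreeLT k N d →ₗ[k] degreeLT i d :=
      ((i : UCoord k N →ₗ[k] A).restrict fun y hy => Submodule.mem_map_of_mem hy)
    refine ⟨TensorProduct.map j j x, ?_⟩
    rw [← LinearMap.comp_apply, ← LinearMap.comp_apply, ← TensorProduct.map_comp,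
      ← TensorProduct.map_comp]
    rfl

end

/-! ## The additive group and its Frobenius kernels -/

section

open Polynomial

variable (k : Type*) [Field k]

/-- The coproduct of `k[𝔾_a] = k[T]`: `T ↦ T ⊗ 1 + 1 ⊗ T`. -/
def gaComul : k[X] →ₐ[k] k[X] ⊗[k] k[X] := aeval (X ⊗ₜ[k] 1 + 1 ⊗ₜ[k] X)

/-- The coordinate algebra `k[𝔾_a] = k[T]` of the additive group. -/
instance gaBialgebra : Bialgebra k k[X] :=
  .ofAlgHom (gaComul k) (aeval 0)
    (by
      apply Polynomial.algHom_ext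
      simp [gaComul, Algebra.TensorProduct.one_def, TensorProduct.add_tmul,
        TensorProduct.tmul_add, add_assoc])
    (by apply Polynomial.algHom_ext; simp [gaComul])
    (by apply Polynomial.algHom_ext; simp [gaComul])

instance gaHopfAlgebra : HopfAlgebra k k[X] :=
  .ofAlgHom (aeval (-X))
    (by
      apply Polynomial.algHom_ext
      change Algebra.TensorProduct.lift _ _ (fun _ _ => Commute.all _ _) (gaComul k X) = algebraMap k _ (aeval 0 X)
      simp [gaComul])
    (by
      apply Polynomial.algHom_ext
      change Algebra.TensorProduct.lift _ _ (fun _ _ => Commute.all _ _) (gaComul k X) = algebraMap k _ (aeval 0 X)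
      simp [gaComul])

/-- The subspace `k[T]_{<d}` of polynomials of degree `< d` is a subcoalgebra of `k[𝔾_a]`. -/
instance (d : ℕ) : IsSubcoalgebra (Polynomial.degreeLT k d) where
  comul_mem f hf := by
    classical
    change gaComul k f ∈ _
    rw [degreeLT_eq_span_X_pow] at hf
    induction hf using Submodule.span_induction with
    | zero => simp
    | add x y _ _ hx hy => rw [map_add]; exact add_mem hx hy
    | smul a x _ hx => rw [map_smul]; exact Submodule.smul_mem _ _ hx
    | mem x hx =>
      simp only [Finset.coe_image, Set.mem_image, Finset.mem_coe, Finset.mem_range] at hx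
      obtain ⟨n, hn, rfl⟩ := hx
      rw [map_pow, gaComul, aeval_X, add_pow]
      refine Submodule.sum_mem _ fun m hm => ?_
      have hm : m ≤ n := Nat.lt_succ_iff.1 (Finset.mem_range.1 hm)
      have hX : ∀ l ≤ n, (X : k[X]) ^ l ∈ Polynomial.degreeLT k d := fun l hl =>
        mem_degreeLT.2 ((degree_X_pow_le l).trans_lt (by exact_mod_cast hl.trans_lt hn))
      rw [← nsmul_eq_mul', Algebra.TensorProduct.tmul_pow, Algebra.TensorProduct.tmul_pow,
        Algebra.TensorProduct.tmul_mul_tmul, one_pow, one_pow, one_mul, mul_one]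
      exact Submodule.smul_of_tower_mem _ _
        ⟨⟨_, hX m hm⟩ ⊗ₜ ⟨_, hX (n - m) (Nat.sub_le n m)⟩, by simp⟩

variable (p : ℕ) [hp : Fact p.Prime] [CharP k p] (r : ℕ)

/-- The ideal `(T^{p^r})` of `k[𝔾_a]` defining the `r`-th Frobenius kernel `𝔾_{a(r)}`. -/
def gaFrobIdeal : Ideal k[X] := Ideal.span {X ^ p ^ r}

instance gaFrobIdeal_isCoideal : ((gaFrobIdeal k p r).restrictScalars k).IsCoideal where
  counit_eq_zero f hf := by
    obtain ⟨g, rfl⟩ := Ideal.mem_span_singleton'.1 hf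
    change aeval (0 : k) (g * X ^ p ^ r) = 0
    simp [hp.out.ne_zero]
  map_mkQ_comul_eq_zero f hf := by
    obtain ⟨g, rfl⟩ := Ideal.mem_span_singleton'.1 hf
    have h0 : Ideal.Quotient.mkₐ k (gaFrobIdeal k p r) (X ^ p ^ r) = 0 :=
      Ideal.Quotient.eq_zero_iff_mem.2 (Ideal.mem_span_singleton_self _)
    have : ExpChar (k[X] ⊗[k] k[X]) p := by
      have : CharP (k[X] ⊗[k] k[X]) p := charP_of_injective_algebraMap
        (FaithfulSMul.algebraMap_injective k (k[X] ⊗[k] k[X])) p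
      exact ExpChar.prime hp.out
    change (Algebra.TensorProduct.map (Ideal.Quotient.mkₐ k (gaFrobIdeal k p r))
      (Ideal.Quotient.mkₐ k (gaFrobIdeal k p r))) (gaComul k (g * X ^ p ^ r)) = 0
    rw [map_mul, map_pow, gaComul, aeval_X, add_pow_expChar_pow, map_mul, map_add,
      Algebra.TensorProduct.tmul_pow, Algebra.TensorProduct.tmul_pow,
      Algebra.TensorProduct.map_tmul, Algebra.TensorProduct.map_tmul, h0]
    simp

/-- The coordinate algebra `k[𝔾_{a(r)}] = k[T]/(T^{p^r})` of the `r`-th Frobenius kernel of the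
additive group; its bialgebra structure is the quotient structure. The group algebra
`k𝔾_{a(r)}` is its dual algebra `WithConv (GaFrob k p r →ₗ[k] k)`. -/
abbrev GaFrob : Type _ := k[X] ⧸ gaFrobIdeal k p r

/-- The restriction homomorphism `k[𝔾_a] → k[𝔾_{a(r)}]`. -/
def gaRes : k[X] →ₗc[k] GaFrob k p r :=
  (Bialgebra.Quotient.mkBialgHom (R := k) (gaFrobIdeal k p r) : k[X] →ₗc[k] GaFrob k p r)

end

section

variable {k : Type*} [Field k] {M : Type*} [AddCommGroup M] [Module k M]

/-- For a rational `𝔾_a`-module `M`, the submodule `M_{<d}` (for `d = p^r`), consisting of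
those `m` with `Δ_M(m) ∈ M ⊗ k[T]_{<d}`, viewed as a rational `𝔾_a`-module and then restricted
to the Frobenius kernel `𝔾_{a(r)}`. -/
def RightComodule.gaPart (ρ : RightComodule k (Polynomial k) M) (p : ℕ) [Fact p.Prime]
    [CharP k p] (r : ℕ) :
    RightComodule k (GaFrob k p r) (ρ.part (Polynomial.degreeLT k (p ^ r))) :=
  ((ρ.restrict (Polynomial.degreeLT k (p ^ r))).push (subCoalgebraIncl _)).push (gaRes k p r)

end

end RatMod

end

/-! A right `C`-comodule is a module over the dual algebra `C*`. Functionals separate the points of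
`M ⊗ C`, so comodule homomorphisms are exactly the `k`-linear maps commuting with all of `C*`
(`isHom_iff`), and subspaces stable under `C*` are subcomodules (`sub`). Extension problems for
comodules thus become extension problems for modules.

For (1), let `L_B` be the part of `L` with coefficients in a subcoalgebra `B`. The functor `L ↦ L_B`
is right adjoint to corestriction along `B → C`, which preserves injective maps, so it preserves
injective objects. Conversely, let the `B n` increase with union `C`, let every `L_(B n)` be
injective, and take by Zorn a maximal extension of `g : X → L` to a subcomodule `Z` of `Y`.
Injectivity of `L_B` extends the map from `Z_B` to `Y_B`. Since `Z ∩ Y_B = Z_B`, the two maps glue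
on `Z + Y_B`, and maximality gives `Y_B ⊆ Z`. The `Y_(B n)` exhaust `Y`, so `Z = Y`. This is
`isInjective_iff_forall_restrict`, applied to the degree filtration along powers of `p`.

For (2), the composite `k[T]_{<p^r} → k[T] → k[T]/(T^{p^r})` is an isomorphism of coalgebras, so by
the same criterion it remains to compare injective with free over `D = k[T]/(T^{p^r})`. The top
coefficient of `Δ(m)` is a nonzero invariant multiple of `m`, whence an injective `D`-comodule is
cofree on its invariants (`exists_equiv_cofree`). The binomial coefficients of `p^r - 1` are nonzero
in `k`, so `D` is free over `D*` on the class of `T^{p^r-1}` (`bijective_dualAct_gaRes_X_pow`).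
Hence cofree comodules are the same as free modules. -/

noncomputable section

namespace RatMod

/-! ### Comodules as modules over the dual algebra -/

section

variable {k C D E M N : Type*} [Field k]
  [AddCommGroup C] [Module k C] [Coalgebra k C]
  [AddCommGroup D] [Module k D] [Coalgebra k D]
  [AddCommGroup E] [Module k E] [Coalgebra k E]
  [AddCommGroup M] [Module k M] [AddCommGroup N] [Module k N]

/-- Functionals on the second factor separate the points of a tensor product. -/
theorem eq_of_forall_functional {V : Type*} [AddCommGroup V] [Module k V] {x y : M ⊗[k] V}
    (h : ∀ φ : V →ₗ[k] k, TensorProduct.rid k M (φ.lTensor M x) =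
      TensorProduct.rid k M (φ.lTensor M y)) : x = y := by
  classical
  apply (TensorProduct.equivFinsuppOfBasisRight (M := M) (Module.Basis.ofVectorSpace k V)).injective
  ext i
  rw [TensorProduct.equivFinsuppOfBasisRight_apply, TensorProduct.equivFinsuppOfBasisRight_apply, h]

theorem rid_lTensor_rTensor {V : Type*} [AddCommGroup V] [Module k V] (f : M →ₗ[k] N)
    (φ : V →ₗ[k] k) (x : M ⊗[k] V) :
    TensorProduct.rid k N (φ.lTensor N (f.rTensor V x)) =
      f (TensorProduct.rid k M (φ.lTensor M x)) := by
  induction x with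
  | zero => simp
  | add a b ha hb => simp only [map_add, ha, hb]
  | tmul a b => simp

/-- Pass to `(M ⧸ P) ⊗ V`: by exactness, membership means that the image of `x` there is zero, which
functionals on `V` detect. This turns stability under `C*` into a coaction on the subspace. -/
theorem mem_range_rTensor_of_forall_functional {V : Type*} [AddCommGroup V] [Module k V]
    (P : Submodule k M) {x : M ⊗[k] V}
    (h : ∀ φ : V →ₗ[k] k, TensorProduct.rid k M (φ.lTensor M x) ∈ P) :
    x ∈ LinearMap.range (P.subtype.rTensor V) := by
  have hex : Function.Exact (P.subtype.rTensor V) (P.mkQ.rTensor V) :=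
    Module.Flat.rTensor_exact V (LinearMap.exact_subtype_mkQ P)
  refine (hex x).1 (eq_of_forall_functional fun φ => ?_)
  rw [rid_lTensor_rTensor, map_zero, map_zero]
  exact (Submodule.Quotient.mk_eq_zero P).2 (h φ)

namespace RightComodule

theorem dualAct_apply (ρ : RightComodule k C M) (φ : C →ₗ[k] k) (m : M) :
    ρ.dualAct φ m = TensorProduct.rid k M (φ.lTensor M (ρ.coact m)) := rfl

theorem dualModule_isScalarTower (ρ : RightComodule k C M) :
    letI := ρ.dualModule
    IsScalarTower k (WithConv (C →ₗ[k] k)) M := by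
  let _ := ρ.dualModule
  refine ⟨fun a φ m => ?_⟩
  change ρ.dualAct (a • φ.ofConv) m = a • ρ.dualAct φ.ofConv m
  simp [dualAct_apply]

/-- Functionals on `C` separate the points of `N ⊗ C`, so the coaction is recovered from the action
of `C*`. -/
theorem isHom_iff {ρ : RightComodule k C M} {σ : RightComodule k C N} {f : M →ₗ[k] N} :
    ρ.IsHom σ f ↔ ∀ φ m, f (ρ.dualAct φ m) = σ.dualAct φ (f m) := by
  constructor
  · intro h φ m
    have := LinearMap.congr_fun h m
    simp only [LinearMap.comp_apply] at this
    rw [dualAct_apply, dualAct_apply, ← this, rid_lTensor_rTensor]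
  · intro h
    ext m
    refine eq_of_forall_functional fun φ => ?_
    rw [LinearMap.comp_apply, LinearMap.comp_apply, rid_lTensor_rTensor]
    exact h φ m

theorem IsHom.apply {ρ : RightComodule k C M} {σ : RightComodule k C N} {f : M →ₗ[k] N}
    (h : ρ.IsHom σ f) (m : M) : f.rTensor C (ρ.coact m) = σ.coact (f m) :=
  LinearMap.congr_fun h m

theorem IsHom.comp {Q : Type*} [AddCommGroup Q] [Module k Q] {ρ : RightComodule k C M}
    {σ : RightComodule k C N} {τ : RightComodule k C Q} {g : N →ₗ[k] Q} {f : M →ₗ[k] N}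
    (hg : σ.IsHom τ g) (hf : ρ.IsHom σ f) : ρ.IsHom τ (g ∘ₗ f) :=
  isHom_iff.2 fun φ m => by
    rw [LinearMap.comp_apply, isHom_iff.1 hf, isHom_iff.1 hg, LinearMap.comp_apply]

theorem IsHom.symm {ρ : RightComodule k C M} {σ : RightComodule k C N} {e : M ≃ₗ[k] N}
    (h : ρ.IsHom σ e.toLinearMap) : σ.IsHom ρ e.symm.toLinearMap :=
  isHom_iff.2 fun φ n => by
    have := isHom_iff.1 h φ (e.symm n)
    apply e.injective
    simpa using this.symm

theorem isHom_id (ρ : RightComodule k C M) : ρ.IsHom ρ LinearMap.id :=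
  isHom_iff.2 fun _ _ => rfl

/-- A comodule homomorphism, as a linear map over the dual algebra. -/
def IsHom.toDualLinear {ρ : RightComodule k C M} {σ : RightComodule k C N} {f : M →ₗ[k] N}
    (h : ρ.IsHom σ f) :
    letI := ρ.dualModule
    letI := σ.dualModule
    M →ₗ[WithConv (C →ₗ[k] k)] N :=
  letI := ρ.dualModule
  letI := σ.dualModule
  { toFun := f
    map_add' := map_add f
    map_smul' := fun φ m => isHom_iff.1 h φ.ofConv m }

/-! ### Corestriction -/

theorem push_coact (ρ : RightComodule k C M) (π : C →ₗc[k] D) :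
    (ρ.push π).coact = π.toLinearMap.lTensor M ∘ₗ ρ.coact := rfl

theorem push_dualAct (ρ : RightComodule k C M) (π : C →ₗc[k] D) (φ : D →ₗ[k] k) :
    (ρ.push π).dualAct φ = ρ.dualAct (φ ∘ₗ π.toLinearMap) := by
  ext m
  rw [dualAct_apply, dualAct_apply, LinearMap.lTensor_comp]
  rfl

theorem push_push (ρ : RightComodule k C M) (π : C →ₗc[k] D) (π' : D →ₗc[k] E) :
    (ρ.push π).push π' = ρ.push (π'.comp π) := by
  ext1
  change π'.toLinearMap.lTensor M ∘ₗ π.toLinearMap.lTensor M ∘ₗ ρ.coact =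
    (π'.toLinearMap ∘ₗ π.toLinearMap).lTensor M ∘ₗ ρ.coact
  rw [LinearMap.lTensor_comp, LinearMap.comp_assoc]

theorem push_id (ρ : RightComodule k C M) : ρ.push (CoalgHom.id k C) = ρ := by
  ext1
  change (LinearMap.id : C →ₗ[k] C).lTensor M ∘ₗ ρ.coact = ρ.coact
  rw [LinearMap.lTensor_id, LinearMap.id_comp]

theorem IsHom.push {ρ : RightComodule k C M} {σ : RightComodule k C N} {f : M →ₗ[k] N}
    (h : ρ.IsHom σ f) (π : C →ₗc[k] D) : (ρ.push π).IsHom (σ.push π) f :=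
  isHom_iff.2 fun φ m => by
    rw [push_dualAct, push_dualAct]
    exact isHom_iff.1 h _ m

/-! ### Subcomodules -/

/-- The comodule structure on a subspace that is stable under the dual algebra. -/
def sub (ρ : RightComodule k C M) (P : Submodule k M)
    (hP : ∀ φ, ∀ m ∈ P, ρ.dualAct φ m ∈ P) : RightComodule k C P where
  coact := factorThrough (P.subtype.rTensor C)
    (Module.Flat.rTensor_preserves_injective_linearMap _ P.injective_subtype)
    (ρ.coact ∘ₗ P.subtype)
    fun m => mem_range_rTensor_of_forall_functional P fun φ => hP φ m m.2
  coassoc := by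
    have hinj : Function.Injective (P.subtype.rTensor (C ⊗[k] C)) :=
      Module.Flat.rTensor_preserves_injective_linearMap _ P.injective_subtype
    have hj := comp_factorThrough (P.subtype.rTensor C)
      (Module.Flat.rTensor_preserves_injective_linearMap _ P.injective_subtype)
      (ρ.coact ∘ₗ P.subtype)
      fun m => mem_range_rTensor_of_forall_functional P fun φ => hP φ m m.2
    set δ := factorThrough (P.subtype.rTensor C)
      (Module.Flat.rTensor_preserves_injective_linearMap _ P.injective_subtype)
      (ρ.coact ∘ₗ P.subtype)
      (fun m => mem_range_rTensor_of_forall_functional P fun φ => hP φ m m.2) with hδ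
    rw [← LinearMap.cancel_left hinj]
    have e1 : P.subtype.rTensor (C ⊗[k] C) ∘ₗ (TensorProduct.assoc k P C C).toLinearMap =
        (TensorProduct.assoc k M C C).toLinearMap ∘ₗ (P.subtype.rTensor C).rTensor C := by
      ext; simp
    calc _ = (P.subtype.rTensor (C ⊗[k] C) ∘ₗ (TensorProduct.assoc k P C C).toLinearMap) ∘ₗ
          δ.rTensor C ∘ₗ δ := rfl
      _ = (TensorProduct.assoc k M C C).toLinearMap ∘ₗ (P.subtype.rTensor C ∘ₗ δ).rTensor C ∘ₗ
          δ := by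
          rw [e1, LinearMap.comp_assoc, ← LinearMap.comp_assoc δ, ← LinearMap.rTensor_comp]
      _ = (TensorProduct.assoc k M C C).toLinearMap ∘ₗ ρ.coact.rTensor C ∘ₗ
          (P.subtype.rTensor C ∘ₗ δ) := by
          rw [hj, LinearMap.rTensor_comp, LinearMap.comp_assoc, hj]
      _ = Coalgebra.comul.lTensor M ∘ₗ (P.subtype.rTensor C ∘ₗ δ) := by
          rw [hj]
          exact congrArg (· ∘ₗ P.subtype) ρ.coassoc
      _ = _ := by
          rw [← LinearMap.comp_assoc, LinearMap.lTensor_comp_rTensor,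
            ← LinearMap.rTensor_comp_lTensor, LinearMap.comp_assoc]
  counit_coact := by
    have hj := comp_factorThrough (P.subtype.rTensor C)
      (Module.Flat.rTensor_preserves_injective_linearMap _ P.injective_subtype)
      (ρ.coact ∘ₗ P.subtype)
      fun m => mem_range_rTensor_of_forall_functional P fun φ => hP φ m m.2
    rw [← LinearMap.cancel_left P.injective_subtype]
    ext m
    have h1 := LinearMap.congr_fun hj m
    have h2 := LinearMap.congr_fun ρ.counit_coact m
    simp only [LinearMap.comp_apply, LinearEquiv.coe_coe] at h1 h2 ⊢
    rw [← rid_lTensor_rTensor, h1]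
    exact h2

theorem isHom_subtype_sub (ρ : RightComodule k C M) (P : Submodule k M)
    (hP : ∀ φ, ∀ m ∈ P, ρ.dualAct φ m ∈ P) : (ρ.sub P hP).IsHom ρ P.subtype :=
  comp_factorThrough _ _ _ _

/-! ### The part of a comodule with coefficients in a subcoalgebra -/

theorem mem_part_iff {ρ : RightComodule k C M} {B : Submodule k C} {m : M} :
    m ∈ ρ.part B ↔ B.mkQ.lTensor M (ρ.coact m) = 0 :=
  ((Module.Flat.lTensor_exact M (LinearMap.exact_subtype_mkQ B)) (ρ.coact m)).symm

theorem IsHom.map_mem_part {ρ : RightComodule k C M} {σ : RightComodule k C N} {f : M →ₗ[k] N}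
    (h : ρ.IsHom σ f) (B : Submodule k C) {m : M} (hm : m ∈ ρ.part B) : f m ∈ σ.part B := by
  rw [mem_part_iff] at hm ⊢
  rw [← h.apply, ← LinearMap.comp_apply, LinearMap.lTensor_comp_rTensor,
    ← LinearMap.rTensor_comp_lTensor, LinearMap.comp_apply, hm, map_zero]

/-- The obstruction to lying in the part lives in `M ⊗ (C ⧸ B)`, and `f ⊗ 1` is injective there by
flatness. For a subcomodule `Z ⊆ Y` this yields `Z ∩ Y_B ⊆ Z_B`. -/
theorem IsHom.mem_part_of_map {ρ : RightComodule k C M} {σ : RightComodule k C N} {f : M →ₗ[k] N}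
    (h : ρ.IsHom σ f) (hf : Function.Injective f) (B : Submodule k C) {m : M}
    (hm : f m ∈ σ.part B) : m ∈ ρ.part B := by
  rw [mem_part_iff] at hm ⊢
  rw [← h.apply, ← LinearMap.comp_apply, LinearMap.lTensor_comp_rTensor,
    ← LinearMap.rTensor_comp_lTensor, LinearMap.comp_apply] at hm
  exact Module.Flat.rTensor_preserves_injective_linearMap f hf (hm.trans (map_zero _).symm)

/-- Because `B` is a subcoalgebra, the coaction sends the part into (part) `⊗ B`, and a functional
contracts only the second factor. So the part is a `C*`-submodule and can serve as the domain of a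
partial linear map. -/
theorem dualAct_mem_part (ρ : RightComodule k C M) (B : Submodule k C) [IsSubcoalgebra B]
    (φ : C →ₗ[k] k) {m : M} (hm : m ∈ ρ.part B) : ρ.dualAct φ m ∈ ρ.part B := by
  obtain ⟨x, hx⟩ := ρ.coact_mem_range B ⟨m, hm⟩
  rw [dualAct_apply, ← hx, ← LinearMap.comp_apply, LinearMap.lTensor_comp_map,
    ← LinearMap.rTensor_comp_lTensor]
  rw [LinearMap.comp_apply]
  generalize (φ ∘ₗ B.subtype).lTensor _ x = y
  have : TensorProduct.rid k M ((ρ.part B).subtype.rTensor k y) =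
      (ρ.part B).subtype (TensorProduct.rid k _ y) := by
    induction y with
    | zero => simp
    | add a b ha hb => simp only [map_add, ha, hb]
    | tmul a b => simp
  rw [this]
  exact Subtype.prop _

/-- The adjunction between corestriction along `B → C` and passage to the part with coefficients in
`B`. -/
theorem isHom_restrict_iff {B : Submodule k C} [IsSubcoalgebra B] {ρ : RightComodule k C M}
    {σ : RightComodule k B N} {g : N →ₗ[k] ρ.part B} :
    σ.IsHom (ρ.restrict B) g ↔
      (σ.push (subCoalgebraIncl B)).IsHom ρ ((ρ.part B).subtype ∘ₗ g) := by
  unfold IsHom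
  rw [← LinearMap.cancel_left (map_subtype_injective (ρ.part B) B), ← LinearMap.comp_assoc,
    ← LinearMap.comp_assoc, map_coact_restrict, LinearMap.map_comp_rTensor, push_coact,
    ← LinearMap.comp_assoc, LinearMap.rTensor_comp_lTensor]
  rfl

theorem isHom_subtype_part (ρ : RightComodule k C M) (B : Submodule k C) [IsSubcoalgebra B] :
    ((ρ.restrict B).push (subCoalgebraIncl B)).IsHom ρ (ρ.part B).subtype := by
  unfold IsHom
  rw [← map_coact_restrict, push_coact, ← LinearMap.comp_assoc, LinearMap.rTensor_comp_lTensor]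
  rfl

/-- A comodule homomorphism restricts to the parts with coefficients in `B`. -/
theorem IsHom.restrict {ρ : RightComodule k C M} {σ : RightComodule k C N} {f : M →ₗ[k] N}
    (h : ρ.IsHom σ f) (B : Submodule k C) [IsSubcoalgebra B] :
    (ρ.restrict B).IsHom (σ.restrict B) (f.restrict fun _ hm => h.map_mem_part B hm) :=
  isHom_restrict_iff.2 (h.comp (ρ.isHom_subtype_part B))

theorem push_part_eq_top {B : Submodule k C} [IsSubcoalgebra B] (σ : RightComodule k B N) :
    (σ.push (subCoalgebraIncl B)).part B = ⊤ :=
  eq_top_iff.2 fun m _ => ⟨σ.coact m, rfl⟩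

/-- An increasing exhaustive family of subspaces of `C` exhausts every comodule. -/
theorem exists_mem_part (ρ : RightComodule k C M) {B : ℕ → Submodule k C} (hB : Monotone B)
    (hB' : ∀ c, ∃ n, c ∈ B n) (m : M) : ∃ n, m ∈ ρ.part (B n) := by
  have (x : M ⊗[k] C) : ∃ n, x ∈ LinearMap.range ((B n).subtype.lTensor M) := by
    have hm {n n' : ℕ} (h : n ≤ n') : LinearMap.range ((B n).subtype.lTensor M) ≤
        LinearMap.range ((B n').subtype.lTensor M) := by
      rintro _ ⟨x, rfl⟩
      refine ⟨(Submodule.inclusion (hB h)).lTensor M x, ?_⟩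
      rw [← LinearMap.comp_apply, ← LinearMap.lTensor_comp]
      rfl
    induction x with
    | zero => exact ⟨0, zero_mem _⟩
    | tmul a c =>
      obtain ⟨n, hn⟩ := hB' c
      exact ⟨n, a ⊗ₜ ⟨c, hn⟩, rfl⟩
    | add x y hx hy =>
      obtain ⟨n, hn⟩ := hx
      obtain ⟨n', hn'⟩ := hy
      exact ⟨max n n', add_mem (hm (le_max_left _ _) hn) (hm (le_max_right _ _) hn')⟩
  exact this (ρ.coact m)

end RightComodule

end

/-! ### Injectivity and exhaustive filtrations by subcoalgebras -/

section

variable {k C D L : Type u} [Field k] [AddCommGroup C] [Module k C] [Coalgebra k C]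
  [AddCommGroup D] [Module k D] [Coalgebra k D] [AddCommGroup L] [Module k L]

namespace RightComodule

theorem IsInjective.push {ρ : RightComodule k C L} (h : ρ.IsInjective) (e : C ≃ₗc[k] D) :
    (ρ.push (e : C →ₗc[k] D)).IsInjective := by
  intro X Y _ _ _ _ σ τ f g hf hinj hg
  have h1 : (e.symm : D →ₗc[k] C).comp (e : C →ₗc[k] D) = CoalgHom.id k C := by
    ext x; simp
  have h2 : (e : C →ₗc[k] D).comp (e.symm : D →ₗc[k] C) = CoalgHom.id k D := by
    ext x; simp
  have hg' := hg.push (e.symm : D →ₗc[k] C)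
  rw [push_push, h1, push_id] at hg'
  obtain ⟨j, hj, hj'⟩ := h X Y _ _ f g (hf.push (e.symm : D →ₗc[k] C)) hinj hg'
  have hj2 := hj.push (e : C →ₗc[k] D)
  rw [push_push, h2, push_id] at hj2
  exact ⟨j, hj2, hj'⟩

theorem isInjective_push_iff {ρ : RightComodule k C L} (e : C ≃ₗc[k] D) :
    (ρ.push (e : C →ₗc[k] D)).IsInjective ↔ ρ.IsInjective := by
  refine ⟨fun h => ?_, fun h => h.push e⟩
  have h1 : (e.symm : D →ₗc[k] C).comp (e : C →ₗc[k] D) = CoalgHom.id k C := by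
    ext x; simp
  have := h.push e.symm
  rwa [push_push, h1, push_id] at this

theorem IsInjective.of_equiv {L' : Type u} [AddCommGroup L'] [Module k L']
    {ρ : RightComodule k C L} {ρ' : RightComodule k C L'} (h : ρ.IsInjective) (e : L ≃ₗ[k] L')
    (he : ρ.IsHom ρ' e.toLinearMap) : ρ'.IsInjective := by
  intro X Y _ _ _ _ σ τ f g hf hinj hg
  obtain ⟨j, hj, hj'⟩ := h X Y σ τ f (e.symm.toLinearMap ∘ₗ g) hf hinj (he.symm.comp hg)
  refine ⟨e.toLinearMap ∘ₗ j, he.comp hj, ?_⟩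
  rw [LinearMap.comp_assoc, hj']
  ext
  simp

/-- A right adjoint of a functor preserving injective maps preserves injective objects. -/
theorem IsInjective.restrict {ρ : RightComodule k C L} (h : ρ.IsInjective) (B : Submodule k C)
    [IsSubcoalgebra B] : (ρ.restrict B).IsInjective := by
  intro X Y _ _ _ _ σ τ f g hf hinj hg
  obtain ⟨j, hj, hj'⟩ := h X Y _ _ f ((ρ.part B).subtype ∘ₗ g)
    (hf.push (subCoalgebraIncl B)) hinj (isHom_restrict_iff.1 hg)
  -- All of a corestricted `B`-comodule has coefficients in `B`, so the extension lands in the part.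
  refine ⟨j.codRestrict (ρ.part B) fun y => hj.map_mem_part B ?_, isHom_restrict_iff.2 hj, ?_⟩
  · rw [push_part_eq_top]
    trivial
  · ext x
    exact LinearMap.congr_fun hj' x

/-- A partial homomorphism into `L` defined on a subcomodule `Z ⊆ Y` extends
to `Z + Y_B`, when the part of `L` with coefficients in `B` is injective. -/
theorem exists_extend_part {ρ : RightComodule k C L} {B : Submodule k C} [IsSubcoalgebra B]
    (h : (ρ.restrict B).IsInjective) {Y : Type u} [AddCommGroup Y] [Module k Y]
    (τ : RightComodule k C Y) :
    letI := τ.dualModule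
    letI := ρ.dualModule
    ∀ a : Y →ₗ.[WithConv (C →ₗ[k] k)] L, ∃ b : Y →ₗ.[WithConv (C →ₗ[k] k)] L,
      a ≤ b ∧ ∀ y ∈ τ.part B, y ∈ b.domain := by
  let _ := τ.dualModule
  let _ := ρ.dualModule
  have := τ.dualModule_isScalarTower
  have := ρ.dualModule_isScalarTower
  intro a
  let Z : Submodule k Y := a.domain.restrictScalars k
  have hZ : ∀ φ, ∀ m ∈ Z, τ.dualAct φ m ∈ Z := fun φ m hm =>
    a.domain.smul_mem (WithConv.toConv φ) hm
  let σ := τ.sub Z hZ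
  have hσ : σ.IsHom τ Z.subtype := τ.isHom_subtype_sub Z hZ
  let g : Z →ₗ[k] L := a.toFun.restrictScalars k
  have hg : σ.IsHom ρ g := isHom_iff.2 fun φ m => by
    have h1 : σ.dualAct φ m = ⟨τ.dualAct φ m, hZ φ m m.2⟩ :=
      Subtype.ext (isHom_iff.1 hσ φ m)
    rw [h1]
    exact a.toFun.map_smul (WithConv.toConv φ) m
  -- Extend the restriction `Z_B → L_B` of the partial map along the inclusion `Z_B → Y_B`.
  obtain ⟨j, hj, hj'⟩ := h _ _ (σ.restrict B) (τ.restrict B) _ _ (hσ.restrict B)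
    (fun x y hxy => Subtype.ext (Subtype.ext (congrArg (τ.part B).subtype hxy))) (hg.restrict B)
  have hJ := isHom_iff.1 (isHom_restrict_iff.1 hj)
  have hτ := isHom_iff.1 (τ.isHom_subtype_part B)
  let c : Y →ₗ.[WithConv (C →ₗ[k] k)] L :=
    { domain :=
        { τ.part B with smul_mem' := fun φ y hy => τ.dualAct_mem_part B φ.ofConv hy }
      toFun :=
        { toFun := fun y => (j ⟨y, y.2⟩ : L)
          map_add' := fun x y => congrArg Subtype.val (j.map_add ⟨x, x.2⟩ ⟨y, y.2⟩)
          map_smul' := fun φ y => by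
            have h1 := hJ φ.ofConv ⟨y, y.2⟩
            have h2 := hτ φ.ofConv ⟨y, y.2⟩
            refine Eq.trans (congrArg (fun z => (j z : L)) (Subtype.ext h2.symm)) h1 } }
  -- The two partial maps agree on the common domain: an element of `Z` lying in `Y_B` already lies
  -- in `Z_B`, where `j` extends `g`.
  have hc (x : a.domain) (y : c.domain) (hxy : (x : Y) = y) : a x = c y := by
    have hx : (⟨x, x.2⟩ : Z) ∈ σ.part B :=
      hσ.mem_part_of_map Z.injective_subtype B (hxy ▸ y.2 : (x : Y) ∈ τ.part B)
    have h1 := congrArg Subtype.val (LinearMap.congr_fun hj' ⟨_, hx⟩)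
    refine Eq.trans h1.symm (congrArg (fun z => (j z : L)) (Subtype.ext hxy))
  exact ⟨a.sup c hc, a.left_le_sup c hc, fun y hy => (a.right_le_sup c hc).1 hy⟩

/-- A comodule is injective if and only if its parts with coefficients in the members of an
increasing exhaustive sequence of subcoalgebras are injective. -/
theorem isInjective_iff_forall_restrict (ρ : RightComodule k C L) (B : ℕ → Submodule k C)
    [∀ n, IsSubcoalgebra (B n)] (hB : Monotone B) (hB' : ∀ c, ∃ n, c ∈ B n) :
    ρ.IsInjective ↔ ∀ n, (ρ.restrict (B n)).IsInjective := by
  refine ⟨fun h n => h.restrict (B n), fun h X Y _ _ _ _ σ τ f g hf hinj hg => ?_⟩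
  let _ := σ.dualModule
  let _ := τ.dualModule
  let _ := ρ.dualModule
  have := σ.dualModule_isScalarTower
  have := τ.dualModule_isScalarTower
  have := ρ.dualModule_isScalarTower
  have : Fact (Function.Injective hf.toDualLinear) := ⟨hinj⟩
  -- Zorn's lemma, applied to partial `C*`-linear maps extending `g`. Subcomodules of `Y` enter only
  -- as `C*`-submodules.
  let E := Module.Baer.extensionOfMax hf.toDualLinear hg.toDualLinear
  have hE : ∀ y, y ∈ E.domain := fun y => by
    obtain ⟨n, hn⟩ := τ.exists_mem_part hB hB' y
    -- The enlarged map is again an extension of `g`, so by maximality it equals `E`, and `y` lies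
    -- in its domain.
    obtain ⟨b, hab, hb⟩ := exists_extend_part (h n) τ E.toLinearPMap
    let E' : Module.Baer.ExtensionOf hf.toDualLinear hg.toDualLinear :=
      { b with
        le := E.le.trans hab.1
        is_extension := fun m => (E.is_extension m).trans (hab.2 rfl) }
    have : E' = E := Module.Baer.extensionOfMax_is_max _ _ E' hab
    rw [← this]
    exact hb y hn
  let j : Y →ₗ[WithConv (C →ₗ[k] k)] L :=
    E.toFun ∘ₗ LinearMap.codRestrict E.domain LinearMap.id hE
  exact ⟨j.restrictScalars k, isHom_iff.2 fun φ m => j.map_smul (WithConv.toConv φ) m,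
    LinearMap.ext fun m => (E.is_extension m).symm⟩

end RightComodule

end

/-! ### Cofree comodules, and free modules over the dual algebra -/

namespace RightComodule

section

variable {k C M V : Type*} [Field k]
  [AddCommGroup C] [Module k C] [Coalgebra k C]
  [AddCommGroup M] [Module k M] [AddCommGroup V] [Module k V]

variable (k C) in
/-- The right regular comodule. -/
def regular : RightComodule k C C where
  coact := Coalgebra.comul
  coassoc := Coalgebra.coassoc
  counit_coact := by
    rw [Coalgebra.lTensor_counit_comp_comul]
    ext; simp

variable (k C V) in
/-- The cofree comodule `V ⊗ C` on the vector space `V`. -/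
def cofree : RightComodule k C (V ⊗[k] C) where
  coact := (TensorProduct.assoc k V C C).symm.toLinearMap ∘ₗ Coalgebra.comul.lTensor V
  coassoc := by
    ext v c
    have h := Coalgebra.coassoc_apply (R := k) c
    simp only [TensorProduct.AlgebraTensorModule.curry_apply, LinearMap.coe_comp,
      Function.comp_apply, TensorProduct.curry_apply, LinearMap.coe_restrictScalars,
      LinearMap.lTensor_tmul, LinearEquiv.coe_coe]
    have h1 : ∀ x : C ⊗[k] C, TensorProduct.assoc k (V ⊗[k] C) C C
        (((TensorProduct.assoc k V C C).symm.toLinearMap ∘ₗ Coalgebra.comul.lTensor V).rTensor C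
          ((TensorProduct.assoc k V C C).symm (v ⊗ₜ x))) =
        (TensorProduct.assoc k V C (C ⊗[k] C)).symm
          (v ⊗ₜ TensorProduct.assoc k C C C (Coalgebra.comul.rTensor C x)) := by
      intro x
      induction x with
      | zero => simp
      | add a b ha hb => simp only [map_add, TensorProduct.tmul_add, ha, hb]
      | tmul a b =>
        simp only [TensorProduct.assoc_symm_tmul, LinearMap.rTensor_tmul, LinearMap.comp_apply,
          LinearMap.lTensor_tmul, LinearEquiv.coe_coe]
        generalize Coalgebra.comul (R := k) a = y
        induction y with
        | zero => simp
        | add a b ha hb => simp only [map_add, TensorProduct.tmul_add, TensorProduct.add_tmul, ha, hb]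
        | tmul a b => simp
    have h2 : ∀ x : C ⊗[k] C, Coalgebra.comul.lTensor (V ⊗[k] C)
          ((TensorProduct.assoc k V C C).symm (v ⊗ₜ x)) =
        (TensorProduct.assoc k V C (C ⊗[k] C)).symm (v ⊗ₜ Coalgebra.comul.lTensor C x) := by
      intro x
      induction x with
      | zero => simp
      | add a b ha hb => simp only [map_add, TensorProduct.tmul_add, ha, hb]
      | tmul a b => simp
    rw [h1, h2, h]
  counit_coact := by
    ext v c
    have h := LinearMap.congr_fun (regular k C).counit_coact c
    simp only [TensorProduct.AlgebraTensorModule.curry_apply, LinearMap.coe_comp,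
      Function.comp_apply, TensorProduct.curry_apply, LinearMap.coe_restrictScalars,
      LinearMap.lTensor_tmul, LinearEquiv.coe_coe, LinearMap.id_apply] at h ⊢
    have h1 : ∀ x : C ⊗[k] C, TensorProduct.rid k (V ⊗[k] C)
        (Coalgebra.counit.lTensor (V ⊗[k] C) ((TensorProduct.assoc k V C C).symm (v ⊗ₜ x))) =
        v ⊗ₜ TensorProduct.rid k C (Coalgebra.counit.lTensor C x) := by
      intro x
      induction x with
      | zero => simp
      | add a b ha hb => simp only [map_add, TensorProduct.tmul_add, ha, hb]
      | tmul a b => simp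
    rw [h1]
    exact congrArg _ h

theorem cofree_coact (x : V ⊗[k] C) :
    (cofree k C V).coact x = (TensorProduct.assoc k V C C).symm (Coalgebra.comul.lTensor V x) := rfl

theorem cofree_dualAct_tmul (φ : C →ₗ[k] k) (v : V) (c : C) :
    (cofree k C V).dualAct φ (v ⊗ₜ c) = v ⊗ₜ (regular k C).dualAct φ c := by
  rw [dualAct_apply, dualAct_apply, cofree_coact, LinearMap.lTensor_tmul]
  change _ = v ⊗ₜ TensorProduct.rid k C (φ.lTensor C (Coalgebra.comul c))
  generalize Coalgebra.comul (R := k) c = y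
  induction y with
  | zero => simp
  | add a b ha hb => simp only [map_add, TensorProduct.tmul_add, ha, hb]
  | tmul a b => simp

/-- The homomorphism into the cofree comodule `V ⊗ C` induced by a linear map to `V`. -/
theorem isHom_cofree (ρ : RightComodule k C M) (π : M →ₗ[k] V) :
    ρ.IsHom (cofree k C V) (π.rTensor C ∘ₗ ρ.coact) := by
  ext m
  have h := LinearMap.congr_fun ρ.coassoc m
  simp only [LinearMap.comp_apply, LinearEquiv.coe_coe] at h
  simp only [LinearMap.comp_apply, cofree_coact]
  rw [LinearEquiv.eq_symm_apply, ← LinearMap.comp_apply (LinearMap.lTensor V _),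
    LinearMap.lTensor_comp_rTensor, ← LinearMap.rTensor_comp_lTensor, LinearMap.comp_apply, ← h,
    LinearMap.rTensor_comp, LinearMap.comp_apply]
  generalize ρ.coact.rTensor C (ρ.coact m) = y
  have : (TensorProduct.assoc k V C C).toLinearMap ∘ₗ (π.rTensor C).rTensor C =
      π.rTensor (C ⊗[k] C) ∘ₗ (TensorProduct.assoc k M C C).toLinearMap := by
    ext; simp
  exact LinearMap.congr_fun this y

/-- A comodule homomorphism into `V ⊗ C` is determined by its composition with `1 ⊗ ε`. -/
theorem eq_of_isHom_cofree {ρ : RightComodule k C M} {f : M →ₗ[k] V ⊗[k] C}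
    (h : ρ.IsHom (cofree k C V) f) :
    (((TensorProduct.rid k V).toLinearMap ∘ₗ Coalgebra.counit.lTensor V) ∘ₗ f).rTensor C ∘ₗ
      ρ.coact = f := by
  rw [LinearMap.rTensor_comp, LinearMap.comp_assoc, h, ← LinearMap.comp_assoc]
  have : ((TensorProduct.rid k V).toLinearMap ∘ₗ Coalgebra.counit.lTensor V).rTensor C ∘ₗ
      (cofree k C V).coact = LinearMap.id := by
    ext v c
    have h := Coalgebra.rTensor_counit_comul (R := k) c
    simp only [TensorProduct.AlgebraTensorModule.curry_apply, LinearMap.coe_comp,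
      Function.comp_apply, TensorProduct.curry_apply, LinearMap.coe_restrictScalars,
      cofree_coact, LinearMap.lTensor_tmul, LinearMap.id_apply]
    have h1 : ∀ x : C ⊗[k] C,
        ((TensorProduct.rid k V).toLinearMap ∘ₗ Coalgebra.counit.lTensor V).rTensor C
          ((TensorProduct.assoc k V C C).symm (v ⊗ₜ x)) =
        v ⊗ₜ TensorProduct.lid k C (Coalgebra.counit.rTensor C x) := by
      intro x
      induction x with
      | zero => simp
      | add a b ha hb => simp only [map_add, TensorProduct.tmul_add, ha, hb]
      | tmul a b => simp [TensorProduct.smul_tmul]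
    rw [h1, h]
    simp
  rw [this, LinearMap.id_comp]

/-- The invariants of `V ⊗ C` with respect to `g` are the elements `v ⊗ g`. -/
theorem exists_eq_tmul_of_cofree_coact {g : C} {x : V ⊗[k] C}
    (h : (cofree k C V).coact x = x ⊗ₜ g) : ∃ v : V, x = v ⊗ₜ g := by
  -- Apply `(1 ⊗ ε) ⊗ 1` to the coaction of `x`: this returns `x`, and on `x ⊗ g` it gives `v ⊗ g`
  -- with `v = (1 ⊗ ε)(x)`.
  have := LinearMap.congr_fun (eq_of_isHom_cofree (isHom_id (cofree k C V))) x
  rw [LinearMap.comp_apply, h] at this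
  exact ⟨_, this.symm⟩

/-- If the regular module over the dual algebra is generated freely by one element, then cofree
comodules are free over the dual algebra: this is `C* ⊗ V ≃ V ⊗ C`. -/
def cofreeEquiv (V : Type*) [AddCommGroup V] [Module k V] (x : C)
    (hx : Function.Bijective fun φ : C →ₗ[k] k => (regular k C).dualAct φ x) :
    letI := (cofree k C V).dualModule
    WithConv (C →ₗ[k] k) ⊗[k] V ≃ₗ[WithConv (C →ₗ[k] k)] V ⊗[k] C :=
  letI := (cofree k C V).dualModule
  let a : WithConv (C →ₗ[k] k) →ₗ[k] C :=
    { toFun := fun φ => (regular k C).dualAct φ.ofConv x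
      map_add' := fun φ ψ => by simp [dualAct_apply]
      map_smul' := fun c φ => by simp [dualAct_apply] }
  let e : WithConv (C →ₗ[k] k) ≃ₗ[k] C :=
    LinearEquiv.ofBijective a (hx.comp (WithConv.equiv (C →ₗ[k] k)).bijective)
  let E : WithConv (C →ₗ[k] k) ⊗[k] V ≃ₗ[k] V ⊗[k] C :=
    TensorProduct.congr e (LinearEquiv.refl k V) ≪≫ₗ TensorProduct.comm k C V
  { E with
    map_smul' := fun φ y => by
      change E (φ • y) = (cofree k C V).dualAct φ.ofConv (E y)
      induction y with
      | zero => simp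
      | add y z hy hz => rw [smul_add, map_add, hy, hz, map_add, map_add]
      | tmul ψ v =>
        let _ := (regular k C).dualModule
        change v ⊗ₜ e (φ * ψ) = (cofree k C V).dualAct φ.ofConv (v ⊗ₜ e ψ)
        rw [cofree_dualAct_tmul]
        exact congrArg (v ⊗ₜ[k] ·) (mul_smul φ ψ x) }

theorem isFreeOverDual_of_cofree {ρ : RightComodule k C M} (x : C)
    (hx : Function.Bijective fun φ : C →ₗ[k] k => (regular k C).dualAct φ x)
    (e : M ≃ₗ[k] V ⊗[k] C) (he : ρ.IsHom (cofree k C V) e.toLinearMap) : ρ.IsFreeOverDual := by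
  let _ := ρ.dualModule
  let _ := (cofree k C V).dualModule
  let e' : M ≃ₗ[WithConv (C →ₗ[k] k)] V ⊗[k] C :=
    { e with map_smul' := fun φ m => isHom_iff.1 he φ.ofConv m }
  exact Module.Free.of_equiv ((cofreeEquiv V x hx).trans e'.symm)

end

section

variable {k C L : Type u} [Field k] [AddCommGroup C] [Module k C] [Coalgebra k C]
  [AddCommGroup L] [Module k L]

/-- Homomorphisms into `V ⊗ C` correspond to linear maps into `V`, and linear maps extend from a
subspace: a `k`-linear retraction `l` of `f` suffices. -/
theorem isInjective_cofree (V : Type u) [AddCommGroup V] [Module k V] :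
    (cofree k C V).IsInjective := by
  intro X Y _ _ _ _ σ τ f g hf hinj hg
  obtain ⟨l, hl⟩ := f.exists_leftInverse_of_injective (LinearMap.ker_eq_bot.2 hinj)
  refine ⟨_, τ.isHom_cofree
    (((TensorProduct.rid k V).toLinearMap ∘ₗ Coalgebra.counit.lTensor V) ∘ₗ g ∘ₗ l), ?_⟩
  rw [LinearMap.comp_assoc, ← hf, ← LinearMap.comp_assoc, ← LinearMap.rTensor_comp,
    LinearMap.comp_assoc, LinearMap.comp_assoc, LinearMap.comp_assoc, hl, LinearMap.comp_id,
    ← LinearMap.comp_assoc]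
  exact eq_of_isHom_cofree hg

/-- A free module is `C* ⊗ V` with `V` spanned by a basis, hence isomorphic to the cofree comodule
`V ⊗ C`. -/
theorem IsFreeOverDual.isInjective {ρ : RightComodule k C L} (h : ρ.IsFreeOverDual) (x : C)
    (hx : Function.Bijective fun φ : C →ₗ[k] k => (regular k C).dualAct φ x) :
    ρ.IsInjective := by
  let _ := ρ.dualModule
  have := ρ.dualModule_isScalarTower
  have h : Module.Free (WithConv (C →ₗ[k] k)) L := h
  let b := Module.Free.chooseBasis (WithConv (C →ₗ[k] k)) L
  let V := Module.Free.ChooseBasisIndex (WithConv (C →ₗ[k] k)) L →₀ k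
  let _ := (cofree k C V).dualModule
  have := (cofree k C V).dualModule_isScalarTower
  let e₁ : WithConv (C →ₗ[k] k) ⊗[k] V ≃ₗ[WithConv (C →ₗ[k] k)] L :=
    (Finsupp.basisSingleOne.baseChange (WithConv (C →ₗ[k] k))).repr.trans b.repr.symm
  let e := (cofreeEquiv V x hx).symm.trans e₁
  exact (isInjective_cofree V).of_equiv (e.restrictScalars k)
    (isHom_iff.2 fun φ m => e.map_smul (WithConv.toConv φ) m)

/-- Suppose that every nonzero element of `L` has a nonzero invariant
multiple. If `L` is injective, then it is cofree on its invariants. -/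
theorem IsInjective.exists_equiv_cofree {ρ : RightComodule k C L} (h : ρ.IsInjective) (g : C)
    (hg : g ≠ 0)
    (H : ∀ (M : Type u) [AddCommGroup M] [Module k M] (σ : RightComodule k C M) (m : M), m ≠ 0 →
      ∃ φ, σ.dualAct φ m ≠ 0 ∧ σ.coact (σ.dualAct φ m) = σ.dualAct φ m ⊗ₜ g) :
    ∃ (V : Type u) (_ : AddCommGroup V) (_ : Module k V) (e : L ≃ₗ[k] V ⊗[k] C),
      ρ.IsHom (cofree k C V) e.toLinearMap := by
  -- `V` is the space of invariants. A linear projection of `L` onto it induces a homomorphism `F`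
  -- to `V ⊗ C` that sends an invariant `v` to `v ⊗ g`.
  let V : Submodule k L := LinearMap.eqLocus ρ.coact ((TensorProduct.mk k L C).flip g)
  have hV (m : L) : m ∈ V ↔ ρ.coact m = m ⊗ₜ g := Iff.rfl
  obtain ⟨π, hπ⟩ := V.subtype.exists_leftInverse_of_injective (Submodule.ker_subtype V)
  let F : L →ₗ[k] V ⊗[k] C := π.rTensor C ∘ₗ ρ.coact
  have hF : ρ.IsHom (cofree k C V) F := ρ.isHom_cofree π
  have hFV (v : V) : F v = v ⊗ₜ g := by
    have h1 : π v = v := LinearMap.congr_fun hπ v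
    rw [LinearMap.comp_apply, (hV v).1 v.2, LinearMap.rTensor_tmul, h1]
  have hg' (v : V) (h : v ⊗ₜ[k] g = 0) : v = 0 := by
    have hφ : ∃ φ : C →ₗ[k] k, φ g ≠ 0 := by
      by_contra! h'
      exact hg ((Module.forall_dual_apply_eq_zero_iff k g).1 h')
    obtain ⟨φ, hφ⟩ := hφ
    have h1 := congrArg (fun y => TensorProduct.rid k V (φ.lTensor V y)) h
    simpa [hφ] using h1
  -- A nonzero element of the kernel would have a nonzero invariant multiple in the kernel, but `F`
  -- is injective on invariants.
  have hFinj : Function.Injective F := by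
    rw [← LinearMap.ker_eq_bot, LinearMap.ker_eq_bot']
    intro m hm
    by_contra hm0
    obtain ⟨φ, hφ, hφ'⟩ := H L ρ m hm0
    have h1 := hFV ⟨_, (hV _).2 hφ'⟩
    rw [isHom_iff.1 hF, hm, map_zero] at h1
    exact hφ (congrArg Subtype.val (hg' _ h1.symm))
  obtain ⟨G, hG, hGF⟩ := h _ _ _ _ F LinearMap.id hF hFinj (isHom_id ρ)
  -- `G` is a retraction of `F`, so injectivity of `G` makes `F` surjective. The same argument
  -- works: the invariants of `V ⊗ C` are the `v ⊗ g = F v`, on which `G` is injective. For this `H`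
  -- is needed for `V ⊗ C` as well as for `L`.
  have hGinj : Function.Injective G := by
    rw [← LinearMap.ker_eq_bot, LinearMap.ker_eq_bot']
    intro y hy
    by_contra hy0
    obtain ⟨φ, hφ, hφ'⟩ := H _ _ y hy0
    obtain ⟨v, hv⟩ := exists_eq_tmul_of_cofree_coact hφ'
    have h1 : G ((cofree k C V).dualAct φ y) = 0 := by rw [isHom_iff.1 hG, hy, map_zero]
    rw [hv, ← hFV] at h1
    have h2 : (v : L) = 0 := (LinearMap.congr_fun hGF v).symm.trans h1
    have h3 : v = 0 := Subtype.ext h2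
    rw [hv, h3, TensorProduct.zero_tmul] at hφ
    exact hφ rfl
  let e : L ≃ₗ[k] V ⊗[k] C := LinearEquiv.ofBijective F
    ⟨hFinj, fun y => ⟨G y, hGinj (LinearMap.congr_fun hGF (G y))⟩⟩
  exact ⟨V, _, _, e, hF⟩

/-- Over a coalgebra with one simple comodule, spanned by `g`, and whose regular
module over the dual algebra is free of rank one, injective comodules are free modules. -/
theorem isInjective_iff_isFreeOverDual {ρ : RightComodule k C L} (x : C)
    (hx : Function.Bijective fun φ : C →ₗ[k] k => (regular k C).dualAct φ x) (g : C)
    (hg : g ≠ 0)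
    (H : ∀ (M : Type u) [AddCommGroup M] [Module k M] (σ : RightComodule k C M) (m : M), m ≠ 0 →
      ∃ φ, σ.dualAct φ m ≠ 0 ∧ σ.coact (σ.dualAct φ m) = σ.dualAct φ m ⊗ₜ g) :
    ρ.IsInjective ↔ ρ.IsFreeOverDual := by
  refine ⟨fun h => ?_, fun h => h.isInjective x hx⟩
  obtain ⟨V, _, _, e, he⟩ := h.exists_equiv_cofree g hg H
  exact isFreeOverDual_of_cofree x hx e he

end

end RightComodule

/-! ### Exhaustion of `k[U]` by the degree filtration -/

section

open MvPolynomial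

variable {k : Type*} [Field k] {N : ℕ} {A : Type*} [CommRing A] [HopfAlgebra k A]

theorem degreeLT_mono (i : UCoord k N →ₐc[k] A) : Monotone (degreeLT i) := fun _ _ h =>
  Submodule.map_mono (Submodule.map_mono (restrictSupport_mono k
    fun _ (ht : _ < _) => lt_of_lt_of_le ht h))

theorem exists_mem_degreeLT {i : UCoord k N →ₐc[k] A} (hi : Function.Surjective i) (a : A) :
    ∃ d, a ∈ degreeLT i d := by
  obtain ⟨f, rfl⟩ := hi a
  obtain ⟨f, rfl⟩ := (uEquiv k N).surjective f
  refine ⟨f.totalDegree + 1, Submodule.mem_map_of_mem (Submodule.mem_map_of_mem ?_)⟩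
  rw [mem_restrictSupport_iff]
  intro s hs
  exact Nat.lt_succ_of_le (le_totalDegree hs)

end

/-! ### Rational modules over the additive group -/

section

open Polynomial

/-- Pascal's rule and the vanishing of `(p^r).choose (j+1)` in `k` show that consecutive
coefficients are negatives of each other; the first is `1`. -/
theorem cast_choose_pow_sub_one_ne_zero (k : Type*) [Field k] (p : ℕ) [hp : Fact p.Prime]
    [CharP k p] (r j : ℕ) (hj : j < p ^ r) : ((p ^ r - 1).choose j : k) ≠ 0 := by
  induction j with
  | zero => simp
  | succ j ih =>
    have h0 : p ^ r - 1 + 1 = p ^ r := Nat.sub_add_cancel (Nat.one_le_pow _ _ hp.out.pos)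
    have h1 := Nat.choose_succ_succ (p ^ r - 1) j
    rw [Nat.succ_eq_add_one, h0] at h1
    have h2 : ((p ^ r).choose (j + 1) : k) = 0 :=
      (CharP.cast_eq_zero_iff k p _).2 (hp.out.dvd_choose_pow j.succ_ne_zero hj.ne)
    rw [h1, Nat.cast_add] at h2
    rw [eq_neg_of_add_eq_zero_right h2]
    exact neg_ne_zero.2 (ih (Nat.lt_of_succ_lt hj))

variable {k : Type*} [Field k]

theorem gaComul_X_pow (n : ℕ) : (Coalgebra.comul (R := k) (X ^ n : k[X]) : k[X] ⊗[k] k[X]) =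
    ∑ m ∈ Finset.range (n + 1), n.choose m • ((X ^ m : k[X]) ⊗ₜ[k] (X ^ (n - m) : k[X])) := by
  change gaComul k (X ^ n) = _
  rw [map_pow, gaComul, aeval_X, add_pow]
  refine Finset.sum_congr rfl fun m _ => ?_
  rw [← nsmul_eq_mul', Algebra.TensorProduct.tmul_pow, Algebra.TensorProduct.tmul_pow,
    Algebra.TensorProduct.tmul_mul_tmul, one_pow, one_pow, one_mul, mul_one]

theorem regular_dualAct_X_pow (φ : k[X] →ₗ[k] k) (n : ℕ) :
    (RightComodule.regular k k[X]).dualAct φ (X ^ n) =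
      ∑ m ∈ Finset.range (n + 1), (n.choose m * φ (X ^ (n - m))) • (X ^ m : k[X]) := by
  rw [RightComodule.dualAct_apply]
  change TensorProduct.rid k k[X] (φ.lTensor k[X] (Coalgebra.comul (R := k) (X ^ n : k[X]))) = _
  rw [gaComul_X_pow, map_sum, map_sum]
  refine Finset.sum_congr rfl fun m _ => ?_
  rw [map_nsmul, map_nsmul, LinearMap.lTensor_tmul, TensorProduct.rid_tmul, ← Nat.cast_smul_eq_nsmul k,
    smul_smul]

/-- The convolution of `ψ` with the `n`-th coefficient functional. -/
theorem conv_lcoeff_X_pow (ψ : k[X] →ₗ[k] k) (n l : ℕ) :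
    (WithConv.toConv ψ * WithConv.toConv (lcoeff k n)).ofConv (X ^ l) =
      if n ≤ l then l.choose n * ψ (X ^ (l - n)) else 0 := by
  change LinearMap.mul' k k (TensorProduct.map ψ (lcoeff k n)
    (Coalgebra.comul (R := k) (X ^ l : k[X]))) = _
  simp only [gaComul_X_pow, map_sum, map_nsmul, TensorProduct.map_tmul, LinearMap.mul'_apply]
  split_ifs with h
  · rw [Finset.sum_eq_single (l - n)]
    · have h' : l - (l - n) = n := Nat.sub_sub_self h
      simp [h', Nat.choose_symm h]
    · intro m hm hne
      have : m < l + 1 := Finset.mem_range.1 hm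
      have h' : n ≠ l - m := by omega
      simp [coeff_X_pow, h']
    · intro hl
      exact absurd (Finset.mem_range.2 (by omega)) hl
  · refine Finset.sum_eq_zero fun m _ => ?_
    have h' : n ≠ l - m := by omega
    simp [coeff_X_pow, h']

namespace RightComodule

variable {M : Type*} [AddCommGroup M] [Module k M]

/-- The components of `Δ(m) = ∑ mₙ ⊗ Tⁿ`. -/
def gaCoeff (σ : RightComodule k k[X] M) (m : M) : ℕ →₀ M :=
  TensorProduct.equivFinsuppOfBasisRight (basisMonomials k) (σ.coact m)

theorem gaCoeff_apply (σ : RightComodule k k[X] M) (m : M) (n : ℕ) :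
    σ.gaCoeff m n = σ.dualAct (lcoeff k n) m := by
  rw [gaCoeff, TensorProduct.equivFinsuppOfBasisRight_apply, dualAct_apply]
  rfl

theorem coact_eq_sum_gaCoeff (σ : RightComodule k k[X] M) (m : M) :
    σ.coact m = (σ.gaCoeff m).sum fun n a => a ⊗ₜ[k] (X ^ n : k[X]) := by
  have := (TensorProduct.equivFinsuppOfBasisRight (M := M) (basisMonomials k)).symm_apply_apply
    (σ.coact m)
  rw [TensorProduct.equivFinsuppOfBasisRight_symm_apply] at this
  rw [← this]
  simp [gaCoeff, monomial_one_right_eq_X_pow]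

theorem dualAct_congr_of_gaCoeff (σ : RightComodule k k[X] M) {φ ψ : k[X] →ₗ[k] k} {m : M}
    (h : ∀ n ∈ (σ.gaCoeff m).support, φ (X ^ n) = ψ (X ^ n)) :
    σ.dualAct φ m = σ.dualAct ψ m := by
  rw [dualAct_apply, dualAct_apply, coact_eq_sum_gaCoeff, Finsupp.sum, map_sum, map_sum, map_sum,
    map_sum]
  refine Finset.sum_congr rfl fun n hn => ?_
  rw [LinearMap.lTensor_tmul, LinearMap.lTensor_tmul, h n hn]

/-- The top component of `Δ(m)` is invariant: every nonzero element of a rational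
`𝔾_a`-module has a nonzero invariant multiple. -/
theorem exists_dualAct_invariant (σ : RightComodule k k[X] M) {m : M} (hm : m ≠ 0) :
    ∃ φ, σ.dualAct φ m ≠ 0 ∧ σ.coact (σ.dualAct φ m) = σ.dualAct φ m ⊗ₜ 1 := by
  have hne : (σ.gaCoeff m).support.Nonempty := by
    rw [Finsupp.support_nonempty_iff]
    intro h
    have h1 := LinearMap.congr_fun σ.counit_coact m
    simp only [LinearMap.comp_apply, coact_eq_sum_gaCoeff, h] at h1
    exact hm (by simpa using h1.symm)
  set n := (σ.gaCoeff m).support.max' hne with hn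
  have hn0 : σ.gaCoeff m n ≠ 0 := Finsupp.mem_support_iff.1 (Finset.max'_mem _ hne)
  rw [gaCoeff_apply] at hn0
  refine ⟨lcoeff k n, hn0, eq_of_forall_functional fun ψ => ?_⟩
  let _ := σ.dualModule
  have h1 : σ.dualAct ψ (σ.dualAct (lcoeff k n) m) =
      σ.dualAct (WithConv.toConv ψ * WithConv.toConv (lcoeff k n)).ofConv m :=
    (mul_smul (WithConv.toConv ψ) (WithConv.toConv (lcoeff k n)) m).symm
  -- Only exponents `l ≤ n` occur in `Δ(m)`. On `T^l` with `l < n` both functionals vanish, and on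
  -- `T^n` both take the value `ψ 1`.
  have h2 : σ.dualAct (WithConv.toConv ψ * WithConv.toConv (lcoeff k n)).ofConv m =
      σ.dualAct (ψ 1 • lcoeff k n) m := by
    refine σ.dualAct_congr_of_gaCoeff fun l hl => ?_
    have hl : l ≤ n := Finset.le_max' _ _ hl
    rw [conv_lcoeff_X_pow]
    rcases hl.eq_or_lt with rfl | hl
    · simp
    · simp [hl.not_ge, coeff_X_pow, hl.ne']
  rw [← dualAct_apply, h1, h2]
  simp [dualAct_apply]

end RightComodule

end

/-! ### The Frobenius kernels and their group algebras -/

section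

variable {k C D : Type*} [Field k] [AddCommGroup C] [Module k C] [Coalgebra k C]
  [AddCommGroup D] [Module k D] [Coalgebra k D]

theorem RightComodule.regular_dualAct_map (π : C →ₗc[k] D) (φ : D →ₗ[k] k) (c : C) :
    (regular k D).dualAct φ (π c) = π ((regular k C).dualAct (φ ∘ₗ π.toLinearMap) c) := by
  rw [dualAct_apply, dualAct_apply]
  change TensorProduct.rid k D (φ.lTensor D (Coalgebra.comul (π c))) =
    π (TensorProduct.rid k C ((φ ∘ₗ π.toLinearMap).lTensor C (Coalgebra.comul c)))
  rw [← CoalgHomClass.map_comp_comul_apply]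
  generalize Coalgebra.comul (R := k) c = y
  induction y with
  | zero => simp
  | add a b ha hb => simp only [map_add, ha, hb]
  | tmul a b => simp

end

section

open Polynomial

variable (k : Type*) [Field k] (p : ℕ) [hp : Fact p.Prime] [CharP k p] (r : ℕ)

theorem gaRes_surjective : Function.Surjective (gaRes k p r) :=
  Ideal.Quotient.mk_surjective

theorem gaRes_eq_zero_iff (f : k[X]) :
    gaRes k p r f = 0 ↔ ∀ d < p ^ r, f.coeff d = 0 := by
  rw [← X_pow_dvd_iff, ← Ideal.mem_span_singleton]
  exact Ideal.Quotient.eq_zero_iff_mem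

instance : Module.Finite k (GaFrob k p r) :=
  (monic_X_pow (p ^ r)).finite_quotient

/-- The composition `k[T]_{<p^r} → k[T] → k[T]/(T^{p^r})` is an isomorphism of coalgebras. -/
def gaFrobEquiv : Polynomial.degreeLT k (p ^ r) ≃ₗc[k] GaFrob k p r :=
  CoalgEquiv.ofBijective (f := (gaRes k p r).comp (subCoalgebraIncl (Polynomial.degreeLT k (p ^ r))))
    (by
      constructor
      · intro f g h
        have h0 : gaRes k p r ((f : k[X]) - g) = 0 := by
          rw [map_sub]
          exact sub_eq_zero.2 h
        rw [gaRes_eq_zero_iff] at h0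
        have hdeg := mem_degreeLT.1 (sub_mem f.2 g.2)
        refine Subtype.ext (sub_eq_zero.1 (Polynomial.ext fun d => ?_))
        rcases lt_or_ge d (p ^ r) with hd | hd
        · exact h0 d hd
        · exact coeff_eq_zero_of_degree_lt (hdeg.trans_le (by exact_mod_cast hd))
      · intro y
        obtain ⟨f, rfl⟩ := gaRes_surjective k p r y
        have hX : (X ^ p ^ r : k[X]).Monic := monic_X_pow _
        refine ⟨⟨f %ₘ X ^ p ^ r, mem_degreeLT.2 ?_⟩, ?_⟩
        · simpa using degree_modByMonic_lt f hX
        · change gaRes k p r (f %ₘ X ^ p ^ r) = gaRes k p r f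
          rw [← sub_eq_zero, ← map_sub, gaRes_eq_zero_iff, ← X_pow_dvd_iff]
          exact dvd_modByMonic_sub f _)

/-- The regular module over the group algebra of `𝔾_{a(r)}` is free on the class of
`T^{p^r - 1}`. -/
theorem bijective_dualAct_gaRes_X_pow : Function.Bijective fun φ : GaFrob k p r →ₗ[k] k =>
    (RightComodule.regular k (GaFrob k p r)).dualAct φ (gaRes k p r (X ^ (p ^ r - 1))) := by
  let a : (GaFrob k p r →ₗ[k] k) →ₗ[k] GaFrob k p r :=
    { toFun := fun φ =>
        (RightComodule.regular k (GaFrob k p r)).dualAct φ (gaRes k p r (X ^ (p ^ r - 1)))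
      map_add' := fun φ ψ => by simp [RightComodule.dualAct_apply]
      map_smul' := fun c φ => by simp [RightComodule.dualAct_apply] }
  have ha : Function.Injective a := by
    rw [← LinearMap.ker_eq_bot, LinearMap.ker_eq_bot']
    intro φ hφ
    have h0 : p ^ r - 1 + 1 = p ^ r := Nat.sub_add_cancel (Nat.one_le_pow _ _ hp.out.pos)
    have h1 : gaRes k p r (∑ m ∈ Finset.range (p ^ r), ((p ^ r - 1).choose m *
        φ (gaRes k p r (X ^ (p ^ r - 1 - m)))) • (X ^ m : k[X])) = 0 := by
      have h := RightComodule.regular_dualAct_map (gaRes k p r) φ (X ^ (p ^ r - 1))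
      rw [regular_dualAct_X_pow, h0] at h
      exact h.symm.trans hφ
    rw [gaRes_eq_zero_iff] at h1
    have h2 : φ ∘ₗ (gaRes k p r).toLinearMap = 0 := by
      refine (basisMonomials k).ext fun j => ?_
      simp only [coe_basisMonomials, monomial_one_right_eq_X_pow]
      change φ (gaRes k p r (X ^ j)) = 0
      rcases lt_or_ge j (p ^ r) with hj | hj
      -- The coefficient of `T^(p^r-1-j)` is `φ(T^j)` times a binomial coefficient that is nonzero
      -- in `k`.
      · have h3 := h1 (p ^ r - 1 - j) (by omega)
        have h4 : p ^ r - 1 - (p ^ r - 1 - j) = j := by omega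
        rw [finsetSum_coeff, Finset.sum_eq_single (p ^ r - 1 - j)] at h3
        · simpa [h4, cast_choose_pow_sub_one_ne_zero k p r (p ^ r - 1 - j) (by omega)] using h3
        · intro b _ hb
          simp [coeff_X_pow, hb.symm]
        · intro hb
          exact absurd (Finset.mem_range.2 (by omega)) hb
      · have : gaRes k p r (X ^ j) = 0 := by
          rw [gaRes_eq_zero_iff]
          intro d hd
          rw [coeff_X_pow, if_neg (by omega)]
        rw [this, map_zero]
    refine LinearMap.ext fun y => ?_
    obtain ⟨f, rfl⟩ := gaRes_surjective k p r y
    exact LinearMap.congr_fun h2 f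
  -- A finite-dimensional space and its dual have the same dimension, so injectivity is enough.
  exact ⟨ha, (LinearMap.injective_iff_surjective_of_finrank_eq_finrank
    (Subspace.dual_finrank_eq (K := k) (V := GaFrob k p r))).1 ha⟩

end

/-! ### Powers of `p` and the criterion for the additive group -/

namespace RightComodule

/-- The subcoalgebras of index `p^r`, `r > 0`, suffice to detect injectivity. -/
theorem isInjective_iff_forall_restrict_pow {k : Type u} [Field k] (p : ℕ)
    [hp : Fact p.Prime] {A L : Type u} [AddCommGroup A] [Module k A] [Coalgebra k A]
    [AddCommGroup L] [Module k L] (ρ : RightComodule k A L) (B : ℕ → Submodule k A)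
    [∀ n, IsSubcoalgebra (B n)] (hB : Monotone B) (hB' : ∀ c, ∃ n, c ∈ B n) :
    ρ.IsInjective ↔ ∀ r : ℕ, 0 < r → (ρ.restrict (B (p ^ r))).IsInjective := by
  refine ⟨fun h r _ => h.restrict _, fun h => ?_⟩
  -- The shift to `n + 1` keeps the exponent positive; the sequence is still exhaustive because `n <
  -- p^n ≤ p^(n+1)`.
  refine (ρ.isInjective_iff_forall_restrict (fun n => B (p ^ (n + 1)))
    (fun a b hab => hB (Nat.pow_le_pow_right hp.out.pos (Nat.succ_le_succ hab))) fun c => ?_).2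
      fun n => h (n + 1) n.succ_pos
  obtain ⟨n, hn⟩ := hB' c
  exact ⟨n, hB ((Nat.lt_pow_self hp.out.one_lt).le.trans
    (Nat.pow_le_pow_right hp.out.pos n.le_succ)) hn⟩

open Polynomial

variable {k : Type u} [Field k] (p : ℕ) [hp : Fact p.Prime] [CharP k p] (r : ℕ)

/-- The inverse of `gaFrobEquiv` embeds `k[𝔾_{a(r)}]` into `k[T]` as a coalgebra, so a comodule over
it becomes a rational `𝔾_a`-module, where the top coefficient is available. -/
theorem exists_dualAct_invariant_gaFrob {M : Type u} [AddCommGroup M] [Module k M]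
    (σ : RightComodule k (GaFrob k p r) M) (m : M) (hm : m ≠ 0) :
    ∃ φ, σ.dualAct φ m ≠ 0 ∧ σ.coact (σ.dualAct φ m) = σ.dualAct φ m ⊗ₜ gaRes k p r 1 := by
  let s : GaFrob k p r →ₗc[k] k[X] := (subCoalgebraIncl (Polynomial.degreeLT k (p ^ r))).comp
    ((gaFrobEquiv k p r).symm : GaFrob k p r →ₗc[k] Polynomial.degreeLT k (p ^ r))
  have hs : Function.Injective s.toLinearMap :=
    Subtype.val_injective.comp (gaFrobEquiv k p r).symm.injective
  have h1 : s (gaRes k p r 1) = 1 := by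
    have h : (1 : k[X]) ∈ Polynomial.degreeLT k (p ^ r) := mem_degreeLT.2
      (degree_one_le.trans_lt (by exact_mod_cast Nat.pow_pos hp.out.pos))
    exact congrArg Subtype.val ((gaFrobEquiv k p r).symm_apply_apply ⟨1, h⟩)
  obtain ⟨φ, hφ, hφ'⟩ := (σ.push s).exists_dualAct_invariant hm
  rw [push_dualAct] at hφ hφ'
  -- Invariance is known after applying `1 ⊗ s`, which is injective, and `s` takes the class of `1`
  -- to `1`.
  refine ⟨φ ∘ₗ s.toLinearMap, hφ,
    Module.Flat.lTensor_preserves_injective_linearMap s.toLinearMap hs ?_⟩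
  refine hφ'.trans ?_
  rw [LinearMap.lTensor_tmul]
  exact congrArg _ h1.symm

theorem isInjective_iff_isFreeOverDual_gaFrob {M : Type u} [AddCommGroup M] [Module k M]
    {σ : RightComodule k (GaFrob k p r) M} : σ.IsInjective ↔ σ.IsFreeOverDual :=
  isInjective_iff_isFreeOverDual _ (bijective_dualAct_gaRes_X_pow k p r) (gaRes k p r 1)
    (fun h => one_ne_zero ((gaRes_eq_zero_iff k p r 1).1 h 0 (Nat.pow_pos hp.out.pos) ▸ coeff_one_zero.symm))
    fun _ _ _ σ m hm => σ.exists_dualAct_invariant_gaFrob p r m hm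

/-- The two corestrictions in `gaPart` compose to corestriction along the isomorphism `gaFrobEquiv`,
so restriction to the Frobenius kernel neither creates nor destroys injectivity of `M_{<p^r}`. -/
theorem gaPart_isFreeOverDual_iff {M : Type u} [AddCommGroup M] [Module k M]
    (σ : RightComodule k k[X] M) : (σ.gaPart p r).IsFreeOverDual ↔
      (σ.restrict (Polynomial.degreeLT k (p ^ r))).IsInjective := by
  rw [← isInjective_iff_isFreeOverDual_gaFrob, ← isInjective_push_iff (gaFrobEquiv k p r), gaPart,
    push_push]
  rfl

theorem ga_isInjective_iff {L : Type u} [AddCommGroup L] [Module k L]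
    (σ : RightComodule k k[X] L) :
    σ.IsInjective ↔ ∀ r : ℕ, 0 < r → (σ.gaPart p r).IsFreeOverDual := by
  simp only [gaPart_isFreeOverDual_iff]
  exact σ.isInjective_iff_forall_restrict_pow p (Polynomial.degreeLT k) (fun _ _ h => Polynomial.degreeLT_mono h)
    fun f => ⟨f.natDegree + 1, mem_degreeLT.2 (degree_lt_iff_coeff_zero _ _ |>.2 fun m hm =>
      coeff_eq_zero_of_natDegree_lt hm)⟩

end RightComodule

end RatMod

end

/-- `A = k[U]` is the coordinate Hopf algebra of a linear algebraic group `U`, and `ρ` is a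
rational `U`-module structure on `L`. -/
theorem mainTheorem3 (p : ℕ) [Fact p.Prime] (k : Type u) [Field k] [IsAlgClosed k] [CharP k p]
    (A : Type u) [CommRing A] [HopfAlgebra k A] [Algebra.FiniteType k A] [IsReduced A]
    (L : Type u) [AddCommGroup L] [Module k L] (ρ : RatMod.RightComodule k A L) :
    (∀ (N : ℕ) (i : RatMod.UCoord k N →ₐc[k] A), Function.Surjective i →
      (ρ.IsInjective ↔
        ∀ r : ℕ, 0 < r → (ρ.restrict (RatMod.degreeLT i (p ^ r))).IsInjective)) ∧
    (∀ e : A ≃ₐc[k] Polynomial k,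
      (ρ.IsInjective ↔
        ∀ r : ℕ, 0 < r →
          ((ρ.push (e : A →ₗc[k] Polynomial k)).gaPart p r).IsFreeOverDual)) := by
  refine ⟨fun N i hi => ρ.isInjective_iff_forall_restrict_pow p (RatMod.degreeLT i) (RatMod.degreeLT_mono i)
    (RatMod.exists_mem_degreeLT hi), fun e => ?_⟩
  rw [← RatMod.RightComodule.ga_isInjective_iff p]
  exact (RatMod.RightComodule.isInjective_push_iff (e : A ≃ₗc[k] Polynomial k)).symm
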